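/- For an integer $N\ge 2$ put $\varepsilon=1/N$, and for $v=(v_0,\dots,v_N)\in\mathbb R^{N+1}$ let $$F_\varepsilon(v)=\sum_{i=1}^{N}\frac1{|\log\varepsilon|}\log\Bigl(1+|\log\varepsilon|\,\frac{|v_i-v_{i-1}|^2}{\varepsilon}\Bigr)$$ be the scaled Perona–Malik energy. Let $N_n\ge 2$ be integers with $\varepsilon_n=1/N_n\to0$, let $\tau_n>0$ with $\tau_n\to0$, and let $u^{0}_{n}\in\mathbb R^{N_n+1}$ be initial data with $\sup_{n,i}|(u^0_n)_i|<\infty$ and $F_{\varepsilon_n}(u^0_n)\le M$ for all $n$ and some constant $M$. For each $n$ let $(u_n^k)_{k\ge0}$ be a discrete minimizing movement: $u_n^0$ is the given initial datum and, for $k\ge1$, $u_n^k$ is a minimizer over $\mathbb R^{N_n+1}$ of $$v\mapsto F_{\varepsilon_n}(v)+\frac1{2\tau_n}\sum_{i=0}^{N_n}\varepsilon_n|v_i-(u_n^{k-1})_i|^2 .$$ Let $v_n(x,t)=(u_n^{\lfloor t/\tau_n\rfloor})_{\lfloor x/\varepsilon_n\rfloor}$ for $(x,t)\in[0,1]\times[0,\infty)$,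 and let $u$ be a measurable function such that $v_n(\cdot,t)\to u(\cdot,t)$ in $L^2(0,1)$ for every $t\ge0$ (in particular, this holds if $v_n\to u$ in $L^2(0,1)$ uniformly for $t\in[0,T]$, for every $T$). Then for every $t\ge0$ the function $u(\cdot,t)$ is piecewise $H^1$ on $(0,1)$, i.e. $H^1$ on $(0,1)$ minus a finite set. Denote by $u_x(\cdot,t)$ its piecewise derivative (the density of the absolutely continuous part of the distributional derivative) and by $S(u(\cdot,t))\subset(0,1)$ its jump set, i.e. the set of points of essential discontinuity. For a.e. $t>0$ one has $u_x(\cdot,t)\in H^1(0,1)$, with weak derivative denoted by $u_{xx}(\cdot,t)$; the functions $u,u_x,u_{xx}$ belong to $L^2((0,1)\times(0,T))$ for every $T>0$; and $$u_t=2u_{xx}\quad\text{in the distributional sense in }(0,1)\times(0,\infty),$$ that is, $-\iint u\,\psi_t\,dx\,dt=2\iint u_{xx}\,\psi\,dx\,dt$ for every $\psi\in C_c^\infty((0,1)\times(0,\infty))$. Moreover, for a.e. $t>0$ the continuous representative of $u_x(\cdot,t)$ on $[0,1]$ satisfies $$u_x(0,t)=u_x(1,t)=0,\qquad u_x(x,t)=0\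 \text{ for all }x\in S(u(\cdot,t)).$$ Finally, if the piecewise-constant interpolations $x\mapsto(u^0_n)_{\lfloor x/\varepsilon_n\rfloor}$ converge a.e. in $(0,1)$ to a function $u^0$, then $u(\cdot,0)=u^0$ a.e. in $(0,1)$. -/

import Mathlib

open MeasureTheory Filter Topology Set
open scoped ContDiff

noncomputable section

namespace PeronaMalik

/-- The lattice spacing `ε = 1/N`. -/
def spacing (N : ℕ) : ℝ := 1 / (N : ℝ)

/-- The scaled one-dimensional Perona–Malik energy of a lattice function `(u_0, …, u_N)`, for the
spacing `ε = 1/N`: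
`F_ε(u) = ∑_{i=1}^N (1/|log ε|) log (1 + |log ε| |u_i - u_{i-1}|² / ε)`. -/
def energy (N : ℕ) (u : Fin (N + 1) → ℝ) : ℝ :=
  ∑ i : Fin N, 1 / |Real.log (spacing N)| *
    Real.log (1 + |Real.log (spacing N)| * (|u i.succ - u i.castSucc| ^ 2 / spacing N))

/-- The functional minimized in one step of the scheme with time step `τ`, starting from `w`:
`v ↦ F_ε(v) + (1/(2τ)) ∑_{i=0}^N ε |v_i - w_i|²`. -/
def stepFunctional (N : ℕ) (τ : ℝ) (w v : Fin (N + 1) → ℝ) : ℝ :=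
  energy N v + 1 / (2 * τ) * ∑ i, spacing N * |v i - w i| ^ 2

/-- `U 0, U 1, U 2, …` is a discrete minimizing movement from the initial state `u₀`: it starts at
`u₀`, and `U (k + 1)` is a (global) minimizer of the step functional that starts from `U k`. -/
def IsDiscreteMovement (N : ℕ) (τ : ℝ) (u₀ : Fin (N + 1) → ℝ) (U : ℕ → Fin (N + 1) → ℝ) : Prop :=
  U 0 = u₀ ∧ ∀ k v, stepFunctional N τ (U k) (U (k + 1)) ≤ stepFunctional N τ (U k) v

/-- Piecewise-constant interpolation in space: `x ↦ w_{⌊x/ε⌋}` for `x ∈ [0,1]`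
(where `⌊x/ε⌋ ≤ N`, so that the minimum has no effect there). -/
def interp (N : ℕ) (w : Fin (N + 1) → ℝ) (x : ℝ) : ℝ :=
  w ⟨min ⌊x / spacing N⌋₊ N, Nat.lt_succ_of_le (min_le_right _ _)⟩

/-- Piecewise-constant interpolation in space and time: `(x, t) ↦ (U_k)_i` with `k = ⌊t/τ⌋` and
`i = ⌊x/ε⌋`. -/
def interpST (N : ℕ) (τ : ℝ) (U : ℕ → Fin (N + 1) → ℝ) (x t : ℝ) : ℝ :=
  interp N (U ⌊t / τ⌋₊) x

/-- `g` is the weak derivative of `f` on the open set `Ω ⊆ ℝ`. -/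
def IsWeakDeriv (Ω : Set ℝ) (f g : ℝ → ℝ) : Prop :=
  ∀ φ : ℝ → ℝ, ContDiff ℝ ∞ φ → HasCompactSupport φ → tsupport φ ⊆ Ω →
    ∫ x in Ω, f x * deriv φ x = - ∫ x in Ω, g x * φ x

/-- `f ∈ H¹(0,1)`, with derivative `g`. -/
def IsH1With (f g : ℝ → ℝ) : Prop :=
  MemLp f 2 (volume.restrict (Ioo 0 1)) ∧ MemLp g 2 (volume.restrict (Ioo 0 1)) ∧
    IsWeakDeriv (Ioo 0 1) f g

/-- `f` is piecewise `H¹` on `(0,1)`, that is `H¹` on `(0,1)` minus a finite set of points, and its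
derivative there (the density of the absolutely continuous part of its distributional derivative)
is `g`. -/
def IsPiecewiseH1With (f g : ℝ → ℝ) : Prop :=
  MemLp f 2 (volume.restrict (Ioo 0 1)) ∧ MemLp g 2 (volume.restrict (Ioo 0 1)) ∧
    ∃ P : Finset ℝ, IsWeakDeriv (Ioo 0 1 \ (P : Set ℝ)) f g

/-- The jump set `S(f)`: the points of `(0,1)` at which `f` has no essential limit, that is, at
which no function that is equal to `f` almost everywhere is continuous. -/
def jumpSet (f : ℝ → ℝ) : Set ℝ :=
  {x | x ∈ Ioo (0 : ℝ) 1 ∧ ¬ ∃ a : ℝ, Tendsto f (𝓝 x ⊓ ae volume) (𝓝 a)}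

/-- The equation `u_t = 2 w` in the sense of distributions on `(0,1) × (0,∞)`. -/
def IsDistribSolution (u w : ℝ → ℝ → ℝ) : Prop :=
  ∀ ψ : ℝ × ℝ → ℝ, ContDiff ℝ ∞ ψ → HasCompactSupport ψ →
    tsupport ψ ⊆ Ioo (0 : ℝ) 1 ×ˢ Ioi (0 : ℝ) →
    - ∫ p in Ioo (0 : ℝ) 1 ×ˢ Ioi (0 : ℝ), u p.1 p.2 * deriv (fun s => ψ (p.1, s)) p.2 =
      2 * ∫ p in Ioo (0 : ℝ) 1 ×ˢ Ioi (0 : ℝ), w p.1 p.2 * ψ p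

/-- `w ∈ L²((0,1) × (0,T))` for every `T > 0`. -/
def IsL2Local (w : ℝ → ℝ → ℝ) : Prop :=
  ∀ T : ℝ, 0 < T →
    MemLp (Function.uncurry w) 2 (volume.restrict (Ioo (0 : ℝ) 1 ×ˢ Ioo (0 : ℝ) T))

end PeronaMalik

end

noncomputable section

namespace PeronaMalik

/-! Write `L = |log ε|`, let `d` be the increment across a bond and `s = L d²/ε` its `excess`. The
derivative of the bond energy is the flux `(2d/ε)/(1+s)`. Since `s/(1+s) ≤ log(1+s)`, an energy
bound `M` bounds the fluxes in `L²` (`sum_flux_sq_le`). Bonds with `d² ≥ √ε` cost at least `1/2`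
each, so there are at most `2M` of them (`card_largeBonds_le`); on the others `d/ε` differs from
half the flux by an amount whose total is at most `ε^(1/4) L M / ε` before multiplication by the
cell size, hence negligible after it. The large bonds therefore concentrate at finitely many points,
and away from these half the weak limit of the fluxes is the derivative of `u`. This makes `u(·,t)`
piecewise `H¹`, and uniqueness of the derivative gives weak convergence of the fluxes to `2u_x`
along the whole sequence, at every `t` (`exists_piecewise_deriv`).

The Euler–Lagrange equation says that the time increment is `τ` times the difference quotient of the
flux, with zero flux at both ends (`euler_lagrange`). It yields the maximum principle and shows that
the squared `L²` norm of the flux difference quotients, the dissipation, has time integral at most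
`2M`. By Fatou its lower limit is finite at a.e. `t`. At such a time, along a suitable ultrafilter,
the difference quotients converge weakly to some `W` and the fluxes converge uniformly to `∫₀ˣ W`,
so `2u_x(x) = ∫₀ˣ W` is `H¹` and vanishes at both ends. Near a jump of `u` there are bonds with
increment at least some `c > 0`; their flux is at most `2/(Lc)`, which tends to `0`, so `u_x`
vanishes there (`limit_flux_eq_zero_of_mem_jumpSet`).

The equation follows by testing the discrete one, moving the differences onto the test function,
passing to the limit at each time and using dominated convergence in time
(`isDistribSolution_of_limit`). For joint measurability, `u_x` and `u_xx` are given by an explicit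
limit formula, `limDeriv` and `limDeriv2`. -/

/-! ### Lattice functions, fluxes and consequences of an energy bound. -/

/-- The scaling factor `|log ε|` of the energy. -/
def logSpacing (N : ℕ) : ℝ := |Real.log (spacing N)|

/-- Extension of a lattice function to all indices, constant beyond `N`. -/
def nodal (N : ℕ) (v : Fin (N + 1) → ℝ) (i : ℕ) : ℝ :=
  v ⟨min i N, Nat.lt_succ_of_le (min_le_right _ _)⟩

/-- The step function with value `a i` on the cell `[iε, (i+1)ε)`. -/
def stepFn (N : ℕ) (a : ℕ → ℝ) (x : ℝ) : ℝ := a ⌊x / spacing N⌋₊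

/-- The increment of a lattice function across the bond `(i, i+1)`. -/
def incr (N : ℕ) (v : Fin (N + 1) → ℝ) (i : ℕ) : ℝ := nodal N v (i + 1) - nodal N v i

/-- The argument `|log ε| d² / ε` of the logarithm in the energy. -/
def excess (N : ℕ) (d : ℝ) : ℝ := logSpacing N * (d ^ 2 / spacing N)

/-- The derivative of the energy of one bond. -/
def flux (N : ℕ) (d : ℝ) : ℝ := 2 * d / spacing N / (1 + excess N d)

/-- The flux through the bond `(i, i+1)`. -/
def bondFlux (N : ℕ) (v : Fin (N + 1) → ℝ) (i : ℕ) : ℝ := flux N (incr N v i)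

/-- The fluxes, indexed by the right end of the bond, with zero flux at the left boundary. -/
def nodalFlux (N : ℕ) (v : Fin (N + 1) → ℝ) : ℕ → ℝ
  | 0 => 0
  | i + 1 => bondFlux N v i

theorem interp_eq_stepFn (N : ℕ) (v : Fin (N + 1) → ℝ) : interp N v = stepFn N (nodal N v) := rfl

theorem spacing_pos {N : ℕ} (h : 2 ≤ N) : 0 < spacing N := by
  unfold spacing
  have : (0 : ℝ) < N := by exact_mod_cast (by omega : 0 < N)
  positivity

theorem natCast_mul_spacing {N : ℕ} (h : 2 ≤ N) : (N : ℝ) * spacing N = 1 := by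
  unfold spacing
  have : (0 : ℝ) < N := by exact_mod_cast (by omega : 0 < N)
  field_simp

theorem logSpacing_eq (N : ℕ) : logSpacing N = Real.log N := by
  unfold logSpacing spacing
  rw [one_div, Real.log_inv, abs_neg, abs_of_nonneg (Real.log_natCast_nonneg N)]

theorem logSpacing_pos {N : ℕ} (h : 2 ≤ N) : 0 < logSpacing N := by
  rw [logSpacing_eq]
  exact Real.log_pos (by exact_mod_cast (by omega : 1 < N))

theorem excess_nonneg (N : ℕ) (d : ℝ) : 0 ≤ excess N d := by
  unfold excess logSpacing spacing
  positivity

theorem nodal_of_le {N : ℕ} (v : Fin (N + 1) → ℝ) {i : ℕ} (h : i ≤ N) :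
    nodal N v i = v ⟨i, Nat.lt_succ_of_le h⟩ := by
  unfold nodal
  congr 2
  exact min_eq_left h

theorem nodal_of_ge {N : ℕ} (v : Fin (N + 1) → ℝ) {i : ℕ} (h : N ≤ i) :
    nodal N v i = v (Fin.last N) := by
  unfold nodal
  congr 1
  ext
  simp [h]

theorem incr_of_ge {N : ℕ} (v : Fin (N + 1) → ℝ) {i : ℕ} (h : N ≤ i) : incr N v i = 0 := by
  rw [incr, nodal_of_ge v h, nodal_of_ge v (h.trans i.le_succ), sub_self]

theorem flux_zero (N : ℕ) : flux N 0 = 0 := by simp [flux]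

theorem bondFlux_of_ge {N : ℕ} (v : Fin (N + 1) → ℝ) {i : ℕ} (h : N ≤ i) :
    bondFlux N v i = 0 := by
  rw [bondFlux, incr_of_ge v h, flux_zero]

theorem sum_bonds_eq {N : ℕ} (v : Fin (N + 1) → ℝ) (f : ℝ → ℝ → ℝ) :
    ∑ i : Fin N, f (v i.castSucc) (v i.succ) =
      ∑ i ∈ Finset.range N, f (nodal N v i) (nodal N v (i + 1)) := by
  rw [Finset.sum_range]
  refine Finset.sum_congr rfl fun i _ => ?_
  rw [nodal_of_le v i.2.le, nodal_of_le v i.2]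
  rfl

theorem sum_nodes_eq {N : ℕ} (v w : Fin (N + 1) → ℝ) (f : ℝ → ℝ → ℝ) :
    ∑ i, f (v i) (w i) = ∑ i ∈ Finset.range (N + 1), f (nodal N v i) (nodal N w i) := by
  rw [Finset.sum_range]
  refine Finset.sum_congr rfl fun i _ => ?_
  rw [nodal_of_le v (Nat.le_of_lt_succ i.2), nodal_of_le w (Nat.le_of_lt_succ i.2)]

theorem energy_eq_sum {N : ℕ} (v : Fin (N + 1) → ℝ) :
    energy N v = ∑ i ∈ Finset.range N,
      1 / logSpacing N * Real.log (1 + excess N (incr N v i)) := by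
  unfold energy
  rw [sum_bonds_eq v (fun a b => 1 / |Real.log (spacing N)| *
    Real.log (1 + |Real.log (spacing N)| * (|b - a| ^ 2 / spacing N)))]
  simp only [sq_abs]
  rfl

/-- The fraction `s/(1+s)` governs both the squared flux and the gap between slope and flux, so this
inequality is how the energy enters. -/
theorem log_one_add_ge {s : ℝ} (hs : 0 ≤ s) : s / (1 + s) ≤ Real.log (1 + s) := by
  have := Real.one_sub_inv_le_log_of_pos (x := 1 + s) (by positivity)
  have h2 : s / (1 + s) = 1 - (1 + s)⁻¹ := by field_simp; ring
  rwa [h2]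

theorem energy_nonneg {N : ℕ} (v : Fin (N + 1) → ℝ) : 0 ≤ energy N v := by
  rw [energy_eq_sum]
  refine Finset.sum_nonneg fun i _ => mul_nonneg ?_ (Real.log_nonneg ?_)
  · unfold logSpacing; positivity
  · linarith [excess_nonneg N (incr N v i)]

theorem sum_log_le {N : ℕ} (h2 : 2 ≤ N) {v : Fin (N + 1) → ℝ} {M : ℝ} (hM : energy N v ≤ M) :
    ∑ i ∈ Finset.range N, Real.log (1 + excess N (incr N v i)) ≤ logSpacing N * M := by
  rw [energy_eq_sum, ← Finset.mul_sum, one_div, inv_mul_le_iff₀ (logSpacing_pos h2)] at hM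
  exact hM

theorem sum_excess_le {N : ℕ} (h2 : 2 ≤ N) {v : Fin (N + 1) → ℝ} {M : ℝ} (hM : energy N v ≤ M) :
    ∑ i ∈ Finset.range N, excess N (incr N v i) / (1 + excess N (incr N v i)) ≤
      logSpacing N * M :=
  (Finset.sum_le_sum fun _ _ => log_one_add_ge (excess_nonneg _ _)).trans (sum_log_le h2 hM)

/-- The left side equals `(4/L) s/(1+s)²`; one factor `1/(1+s) ≤ 1` is dropped. -/
theorem flux_sq_le {N : ℕ} (h2 : 2 ≤ N) (d : ℝ) :
    spacing N * flux N d ^ 2 ≤ 4 / logSpacing N * (excess N d / (1 + excess N d)) := by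
  have hs := excess_nonneg N d
  have hε := spacing_pos h2
  have hL := logSpacing_pos h2
  have hd : d ^ 2 = excess N d * spacing N / logSpacing N := by
    unfold excess; field_simp
  have : spacing N * flux N d ^ 2 =
      4 / logSpacing N * (excess N d / (1 + excess N d)) * (1 / (1 + excess N d)) := by
    unfold flux
    rw [div_pow, div_pow, mul_pow, hd]
    field_simp
    ring
  rw [this]
  refine mul_le_of_le_one_right (by positivity) ?_
  rw [div_le_one (by positivity)]
  linarith

theorem sum_flux_sq_le {N : ℕ} (h2 : 2 ≤ N) {v : Fin (N + 1) → ℝ} {M : ℝ}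
    (hM : energy N v ≤ M) :
    ∑ i ∈ Finset.range N, spacing N * bondFlux N v i ^ 2 ≤ 4 * M := by
  have hL := logSpacing_pos h2
  calc _ ≤ ∑ i ∈ Finset.range N, 4 / logSpacing N *
        (excess N (incr N v i) / (1 + excess N (incr N v i))) :=
        Finset.sum_le_sum fun i _ => flux_sq_le h2 _
    _ ≤ 4 / logSpacing N * (logSpacing N * M) := by
        rw [← Finset.mul_sum]
        exact mul_le_mul_of_nonneg_left (sum_excess_le h2 hM) (by positivity)
    _ = 4 * M := by field_simp

/-- This is `d = d/(1+s) + d s/(1+s)`. The second term is the error made in replacing the slope by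
half the flux, and `sum_excess_le` controls its weights. -/
theorem incr_decomp {N : ℕ} (h2 : 2 ≤ N) (d : ℝ) :
    d = spacing N * (flux N d / 2) + d * (excess N d / (1 + excess N d)) := by
  have hs := excess_nonneg N d
  have hε := spacing_pos h2
  unfold flux
  field_simp

/-- Bounding `1+s` below by `s` leaves `2/(L|d|)`: the flux through a macroscopic jump disappears as
`L → ∞`. -/
theorem abs_flux_le {N : ℕ} (h2 : 2 ≤ N) {c d : ℝ} (hc : 0 < c) (hd : c ≤ |d|) :
    |flux N d| ≤ 2 / (logSpacing N * c) := by
  have hε := spacing_pos h2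
  have hL := logSpacing_pos h2
  have hs := excess_nonneg N d
  have hd0 : 0 < |d| := hc.trans_le hd
  unfold flux
  rw [abs_div, abs_div, abs_mul, abs_of_pos hε, abs_of_pos (by linarith : 0 < 1 + excess N d),
    div_le_div_iff₀ (by linarith) (by positivity), abs_two]
  have h1 : |d| / spacing N * (logSpacing N * |d|) = excess N d := by
    unfold excess; rw [← sq_abs d]; field_simp
  have h3 : 2 * |d| / spacing N * (logSpacing N * c) ≤
      2 * (|d| / spacing N * (logSpacing N * |d|)) := by
    have : 2 * |d| / spacing N * (logSpacing N * c) = 2 * (|d| / spacing N * (logSpacing N * c)) := by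
      ring
    rw [this]
    gcongr
  rw [h1] at h3
  linarith

/-- The bonds across which the lattice function has a large increment. -/
def largeBonds (N : ℕ) (v : Fin (N + 1) → ℝ) : Finset ℕ :=
  {i ∈ Finset.range N | √(spacing N) ≤ incr N v i ^ 2}

/-- On a large bond `s ≥ ε^(-1/2)`, because `N ≥ 3` gives `L ≥ 1`. Its logarithm is then at least
`L/2`, an energy cost of `1/2`. -/
theorem card_largeBonds_le {N : ℕ} (h3 : 3 ≤ N) {v : Fin (N + 1) → ℝ} {M : ℝ}
    (hM : energy N v ≤ M) : ((largeBonds N v).card : ℝ) ≤ 2 * M := by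
  have h2 : 2 ≤ N := by omega
  have hε := spacing_pos h2
  have hL := logSpacing_pos h2
  have hL1 : 1 ≤ logSpacing N := by
    rw [logSpacing_eq, Real.le_log_iff_exp_le (by positivity)]
    have := Real.exp_one_lt_d9
    have : (3 : ℝ) ≤ N := by exact_mod_cast h3
    linarith
  have key : ∀ i ∈ largeBonds N v,
      logSpacing N / 2 ≤ Real.log (1 + excess N (incr N v i)) := by
    intro i hi
    have hi' := (Finset.mem_filter.1 hi).2
    have h1 : logSpacing N / 2 = Real.log (√(spacing N) / spacing N) := by
      rw [Real.log_div (by positivity) hε.ne', Real.log_sqrt hε.le]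
      have : Real.log (spacing N) = - logSpacing N := by
        rw [logSpacing_eq]; unfold spacing; rw [one_div, Real.log_inv]
      rw [this]; ring
    rw [h1]
    refine Real.log_le_log (by positivity) ?_
    have : √(spacing N) / spacing N ≤ incr N v i ^ 2 / spacing N := by gcongr
    have h4 : incr N v i ^ 2 / spacing N ≤ excess N (incr N v i) := by
      unfold excess
      exact le_mul_of_one_le_left (by positivity) hL1
    linarith
  have : (largeBonds N v).card * (logSpacing N / 2) ≤ logSpacing N * M := by
    calc _ ≤ ∑ i ∈ largeBonds N v, Real.log (1 + excess N (incr N v i)) := by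
          rw [← nsmul_eq_mul]
          exact Finset.card_nsmul_le_sum _ _ _ key
      _ ≤ ∑ i ∈ Finset.range N, Real.log (1 + excess N (incr N v i)) := by
          refine Finset.sum_le_sum_of_subset_of_nonneg (Finset.filter_subset _ _) fun i _ _ => ?_
          exact Real.log_nonneg (by linarith [excess_nonneg N (incr N v i)])
      _ ≤ _ := sum_log_le h2 hM
  nlinarith

theorem abs_incr_le_of_notMem {N : ℕ} {v : Fin (N + 1) → ℝ} {i : ℕ}
    (hi : i ∉ largeBonds N v) : |incr N v i| ≤ √√(spacing N) := by
  by_cases hN : i < N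
  · simp only [largeBonds, Finset.mem_filter, Finset.mem_range, hN, true_and, not_le] at hi
    exact Real.abs_le_sqrt hi.le
  · rw [incr_of_ge v (not_lt.1 hN), abs_zero]
    positivity

/-- The oscillation of a lattice function of bounded energy over an interval without increments
larger than `c`. -/
theorem abs_nodal_sub_le {N : ℕ} (h3 : 3 ≤ N) {v : Fin (N + 1) → ℝ} {M : ℝ}
    (hM : energy N v ≤ M) {c : ℝ} (hc0 : 0 ≤ c) {i j : ℕ} (hij : i ≤ j) (hj : j ≤ N)
    (hc : ∀ l ∈ Finset.Ico i j, |incr N v l| ≤ c) :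
    |nodal N v j - nodal N v i| ≤
      √(M * ((j - i : ℝ) * spacing N)) + √√(spacing N) * (logSpacing N * M) + 2 * M * c := by
  have h2 : 2 ≤ N := by omega
  have hε := spacing_pos h2
  have hsub : Finset.Ico i j ⊆ Finset.range N := by
    intro l hl
    rw [Finset.mem_Ico] at hl
    exact Finset.mem_range.2 (by omega)
  have e1 : nodal N v j - nodal N v i = ∑ l ∈ Finset.Ico i j, incr N v l := by
    simp only [incr]
    rw [Finset.sum_Ico_sub _ hij]
  -- Three contributions: the flux part, summed by Cauchy–Schwarz; the error part, with `|d| ≤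
  -- ε^(1/4)` off the large bonds; and at most `c` for each of the at most `2M` large bonds.
  have e2 : ∀ l ∈ Finset.Ico i j, |incr N v l| ≤ spacing N * |bondFlux N v l| / 2 +
      √√(spacing N) * (excess N (incr N v l) / (1 + excess N (incr N v l))) +
      (if l ∈ largeBonds N v then c else 0) := by
    intro l hl
    have hs := excess_nonneg N (incr N v l)
    have hle : excess N (incr N v l) / (1 + excess N (incr N v l)) ≤ 1 := by
      rw [div_le_one (by linarith)]; linarith
    have hge : 0 ≤ excess N (incr N v l) / (1 + excess N (incr N v l)) := by positivity
    by_cases hb : l ∈ largeBonds N v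
    · simp only [hb, if_true]
      have : 0 ≤ spacing N * |bondFlux N v l| / 2 +
        √√(spacing N) * (excess N (incr N v l) / (1 + excess N (incr N v l))) := by positivity
      linarith [hc l hl]
    · simp only [hb, if_false, add_zero]
      have h := incr_decomp h2 (incr N v l)
      calc |incr N v l| = |spacing N * (flux N (incr N v l) / 2) + incr N v l *
            (excess N (incr N v l) / (1 + excess N (incr N v l)))| := congrArg _ h
        _ ≤ _ := abs_add_le _ _
        _ ≤ _ := by
          rw [abs_mul, abs_mul, abs_of_pos hε, abs_div, abs_two, abs_of_nonneg hge, mul_div_assoc]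
          unfold bondFlux
          gcongr
          exact abs_incr_le_of_notMem hb
  have e3 : ∑ l ∈ Finset.Ico i j, spacing N * |bondFlux N v l| / 2 ≤
      √(M * ((j - i : ℝ) * spacing N)) := by
    apply Real.le_sqrt_of_sq_le
    have cs := sq_sum_le_card_mul_sum_sq (s := Finset.Ico i j)
      (f := fun l => spacing N * |bondFlux N v l| / 2)
    refine cs.trans ?_
    rw [Nat.card_Ico, Nat.cast_sub hij]
    have : ∑ l ∈ Finset.Ico i j, (spacing N * |bondFlux N v l| / 2) ^ 2 ≤ spacing N * M := by
      calc _ = spacing N / 4 * ∑ l ∈ Finset.Ico i j, spacing N * bondFlux N v l ^ 2 := by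
            rw [Finset.mul_sum]
            refine Finset.sum_congr rfl fun l _ => ?_
            rw [div_pow, mul_pow, sq_abs]; ring
        _ ≤ spacing N / 4 * (4 * M) := by
            refine mul_le_mul_of_nonneg_left ?_ (by positivity)
            refine (Finset.sum_le_sum_of_subset_of_nonneg hsub fun l _ _ => ?_).trans
              (sum_flux_sq_le h2 hM)
            positivity
        _ = _ := by ring
    have hji : (0 : ℝ) ≤ (j : ℝ) - i := by
      rw [sub_nonneg]; exact_mod_cast hij
    nlinarith [mul_le_mul_of_nonneg_left this hji]
  have e4 : ∑ l ∈ Finset.Ico i j,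
      √√(spacing N) * (excess N (incr N v l) / (1 + excess N (incr N v l))) ≤
      √√(spacing N) * (logSpacing N * M) := by
    rw [← Finset.mul_sum]
    refine mul_le_mul_of_nonneg_left ?_ (by positivity)
    refine (Finset.sum_le_sum_of_subset_of_nonneg hsub fun l _ _ => ?_).trans (sum_excess_le h2 hM)
    have hs := excess_nonneg N (incr N v l)
    positivity
  have e5 : ∑ l ∈ Finset.Ico i j, (if l ∈ largeBonds N v then c else 0) ≤ 2 * M * c := by
    rw [← Finset.sum_filter, Finset.sum_const, nsmul_eq_mul]
    refine mul_le_mul_of_nonneg_right ?_ hc0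
    refine le_trans ?_ (card_largeBonds_le h3 hM)
    exact_mod_cast Finset.card_le_card (fun l hl => (Finset.mem_filter.1 hl).2)
  rw [e1]
  calc _ ≤ ∑ l ∈ Finset.Ico i j, |incr N v l| := Finset.abs_sum_le_sum_abs _ _
    _ ≤ _ := Finset.sum_le_sum e2
    _ ≤ _ := by
      rw [Finset.sum_add_distrib, Finset.sum_add_distrib]
      linarith

/-! ### Asymptotics of the spacing and of its logarithm. -/

theorem tendsto_spacing {N : ℕ → ℕ} (hN : Tendsto N atTop atTop) :
    Tendsto (fun n => spacing (N n)) atTop (𝓝 0) := by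
  have : Tendsto (fun k : ℕ => 1 / (k : ℝ)) atTop (𝓝 0) := tendsto_one_div_atTop_nhds_zero_nat
  exact this.comp hN

theorem tendsto_logSpacing {N : ℕ → ℕ} (hN : Tendsto N atTop atTop) :
    Tendsto (fun n => logSpacing (N n)) atTop atTop := by
  simp only [logSpacing_eq]
  exact (Real.tendsto_log_atTop.comp tendsto_natCast_atTop_atTop).comp hN

theorem tendsto_sqrt_sqrt_spacing_mul_logSpacing {N : ℕ → ℕ} (hN : Tendsto N atTop atTop) :
    Tendsto (fun n => √√(spacing (N n)) * logSpacing (N n)) atTop (𝓝 0) := by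
  have h1 : Tendsto (fun x : ℝ => Real.log x / x ^ (1 / 4 : ℝ)) atTop (𝓝 0) :=
    (isLittleO_log_rpow_atTop (by norm_num)).tendsto_div_nhds_zero
  have h2 := (h1.comp tendsto_natCast_atTop_atTop).comp hN
  refine h2.congr fun n => ?_
  simp only [Function.comp_apply, logSpacing_eq]
  have : √√(spacing (N n)) = 1 / (N n : ℝ) ^ (1 / 4 : ℝ) := by
    unfold spacing
    rw [Real.sqrt_eq_rpow, Real.sqrt_eq_rpow, ← Real.rpow_mul (by positivity),
      Real.div_rpow (by positivity) (by positivity), Real.one_rpow]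
    norm_num
  rw [this]; ring

/-! ### Weak convergence in `L²` along ultrafilters. -/

section WeakConvergence

theorem integrable_mul_of_memLp {α : Type*} [MeasurableSpace α] {μ : Measure α} {f g : α → ℝ}
    (hf : MemLp f 2 μ) (hg : MemLp g 2 μ) : Integrable (fun x => f x * g x) μ :=
  hf.integrable_mul hg

theorem integral_mul_eq_inner {α : Type*} [MeasurableSpace α] {μ : Measure α} {f g : α → ℝ}
    (hf : MemLp f 2 μ) (hg : MemLp g 2 μ) :
    ∫ x, f x * g x ∂μ = inner ℝ (hf.toLp f) (hg.toLp g) := by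
  rw [L2.inner_def]
  refine integral_congr_ae ?_
  filter_upwards [hf.coeFn_toLp, hg.coeFn_toLp] with x h1 h2
  rw [h1, h2, real_inner_eq_re_inner]
  simp [mul_comm]

theorem norm_toLp_sq {α : Type*} [MeasurableSpace α] {μ : Measure α} {f : α → ℝ}
    (hf : MemLp f 2 μ) : ‖hf.toLp f‖ ^ 2 = ∫ x, f x ^ 2 ∂μ := by
  rw [← real_inner_self_eq_norm_sq, ← integral_mul_eq_inner]
  simp only [pow_two]

theorem toReal_eLpNorm_sq {α : Type*} [MeasurableSpace α] {μ : Measure α} {f : α → ℝ}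
    (hf : MemLp f 2 μ) : (eLpNorm f 2 μ).toReal ^ 2 = ∫ x, f x ^ 2 ∂μ := by
  rw [← norm_toLp_sq hf, Lp.norm_toLp]

theorem abs_integral_mul_le {α : Type*} [MeasurableSpace α] {μ : Measure α} {f g : α → ℝ}
    (hf : MemLp f 2 μ) (hg : MemLp g 2 μ) :
    |∫ x, f x * g x ∂μ| ≤ √(∫ x, f x ^ 2 ∂μ) * √(∫ x, g x ^ 2 ∂μ) := by
  rw [integral_mul_eq_inner hf hg, ← norm_toLp_sq hf, ← norm_toLp_sq hg,
    Real.sqrt_sq (norm_nonneg _), Real.sqrt_sq (norm_nonneg _)]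
  exact abs_real_inner_le_norm _ _

/-- Banach–Alaoglu, transported by the Riesz isometry. The ultrafilter takes the place of a
subsequence, so separability plays no role. -/
theorem exists_weak_limit_of_bounded {H : Type*} [NormedAddCommGroup H] [InnerProductSpace ℝ H]
    [CompleteSpace H] (𝒰 : Ultrafilter ℕ) {F : ℕ → H} {R : ℝ} (hF : ∀ᶠ n in 𝒰, ‖F n‖ ≤ R) :
    ∃ z : H, ‖z‖ ≤ R ∧ ∀ φ, Tendsto (fun n => inner ℝ (F n) φ) 𝒰 (𝓝 (inner ℝ z φ)) := by
  let G : ℕ → WeakDual ℝ H := fun n =>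
    StrongDual.toWeakDual (InnerProductSpace.toDual ℝ H (F n))
  have hc := WeakDual.isCompact_closedBall (𝕜 := ℝ) (E := H) 0 R
  obtain ⟨ℓ, hℓ, hlim⟩ := hc.ultrafilter_le_nhds' (𝒰.map G) (by
    rw [Ultrafilter.mem_map]
    filter_upwards [hF] with n hn
    simpa [G] using hn)
  refine ⟨(InnerProductSpace.toDual ℝ H).symm (WeakDual.toStrongDual ℓ), ?_, fun φ => ?_⟩
  · rw [LinearIsometryEquiv.norm_map]
    simpa using hℓ
  · have h1 : Tendsto G 𝒰 (𝓝 ℓ) := hlim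
    have h2 := ((WeakDual.eval_continuous (𝕜 := ℝ) φ).tendsto ℓ).comp h1
    rw [InnerProductSpace.toDual_symm_apply]
    exact h2

/-- Weak convergence in `L²(μ)`, tested with all square integrable functions. -/
def WeakTendsto {α : Type*} [MeasurableSpace α] (μ : Measure α) (f : ℕ → α → ℝ) (l : Filter ℕ)
    (g : α → ℝ) : Prop :=
  ∀ φ : α → ℝ, MemLp φ 2 μ → Tendsto (fun n => ∫ x, f n x * φ x ∂μ) l (𝓝 (∫ x, g x * φ x ∂μ))

theorem exists_weakTendsto {α : Type*} [MeasurableSpace α] {μ : Measure α} (𝒰 : Ultrafilter ℕ)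
    {f : ℕ → α → ℝ} (hf : ∀ n, MemLp (f n) 2 μ) {B : ℝ}
    (hB : ∀ᶠ n in 𝒰, ∫ x, f n x ^ 2 ∂μ ≤ B) :
    ∃ g, MemLp g 2 μ ∧ ∫ x, g x ^ 2 ∂μ ≤ B ∧ WeakTendsto μ f 𝒰 g := by
  have hB0 : 0 ≤ B := by
    obtain ⟨n, hn⟩ := hB.exists
    exact le_trans (integral_nonneg fun _ => sq_nonneg _) hn
  obtain ⟨z, hz, hlim⟩ := exists_weak_limit_of_bounded 𝒰 (F := fun n => (hf n).toLp (f n))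
    (R := √B) (by
      filter_upwards [hB] with n hn
      apply Real.le_sqrt_of_sq_le
      rwa [norm_toLp_sq])
  have hz2 := Lp.memLp z
  refine ⟨z, hz2, ?_, fun φ hφ => ?_⟩
  · rw [← norm_toLp_sq hz2, Lp.toLp_coeFn]
    calc ‖z‖ ^ 2 ≤ √B ^ 2 := by gcongr
      _ = B := Real.sq_sqrt hB0
  · rw [integral_mul_eq_inner hz2 hφ, Lp.toLp_coeFn]
    refine (hlim (hφ.toLp φ)).congr fun n => ?_
    rw [integral_mul_eq_inner (hf n) hφ]

theorem weakTendsto_of_tendsto_eLpNorm {α : Type*} [MeasurableSpace α] {μ : Measure α}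
    {f : ℕ → α → ℝ} (hf : ∀ n, MemLp (f n) 2 μ) {g : α → ℝ} (hg : MemLp g 2 μ) {l : Filter ℕ}
    (h : Tendsto (fun n => eLpNorm (fun x => f n x - g x) 2 μ) l (𝓝 0)) :
    WeakTendsto μ f l g := by
  intro φ hφ
  rw [tendsto_iff_norm_sub_tendsto_zero]
  have h1 : Tendsto (fun n => (eLpNorm (fun x => f n x - g x) 2 μ).toReal *
      √(∫ x, φ x ^ 2 ∂μ)) l (𝓝 0) := by
    have := ((ENNReal.tendsto_toReal ENNReal.zero_ne_top).comp h).mul_const (√(∫ x, φ x ^ 2 ∂μ))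
    simpa using this
  refine squeeze_zero (fun _ => norm_nonneg _) (fun n => ?_) h1
  have hd : MemLp (fun x => f n x - g x) 2 μ := (hf n).sub hg
  rw [← integral_sub (integrable_mul_of_memLp (hf n) hφ) (integrable_mul_of_memLp hg hφ)]
  have := abs_integral_mul_le hd hφ
  rw [← toReal_eLpNorm_sq hd, Real.sqrt_sq ENNReal.toReal_nonneg] at this
  simpa only [sub_mul, Real.norm_eq_abs] using this

/-- Weak convergence paired with uniform convergence; it is applied to difference quotients of test
functions, which vary with `n`. -/
theorem WeakTendsto.integral_mul_of_uniform {α : Type*} [MeasurableSpace α] {μ : Measure α}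
    [IsProbabilityMeasure μ] {f : ℕ → α → ℝ} {g : α → ℝ} {l : Filter ℕ} (h : WeakTendsto μ f l g)
    (hf : ∀ n, MemLp (f n) 2 μ) {B : ℝ} (hB : ∀ᶠ n in l, ∫ x, f n x ^ 2 ∂μ ≤ B)
    {φ : ℕ → α → ℝ} {ψ : α → ℝ} (hφ : ∀ n, MemLp (φ n) 2 μ) (hψ : MemLp ψ 2 μ)
    {r : ℕ → ℝ} (hr : Tendsto r l (𝓝 0)) (hφψ : ∀ᶠ n in l, ∀ x, |φ n x - ψ x| ≤ r n) :
    Tendsto (fun n => ∫ x, f n x * φ n x ∂μ) l (𝓝 (∫ x, g x * ψ x ∂μ)) := by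
  have h0 : Tendsto (fun n => ∫ x, f n x * (φ n x - ψ x) ∂μ) l (𝓝 0) := by
    have h1 : Tendsto (fun n => √B * r n) l (𝓝 0) := by simpa using hr.const_mul (√B)
    refine squeeze_zero_norm' ?_ h1
    filter_upwards [hB, hφψ] with n h2 h3
    have hd : MemLp (fun x => φ n x - ψ x) 2 μ := (hφ n).sub hψ
    refine (abs_integral_mul_le (hf n) hd).trans ?_
    have hr0 : 0 ≤ r n := by
      obtain ⟨x⟩ : Nonempty α := μ.nonempty_of_neZero
      exact (abs_nonneg _).trans (h3 x)
    refine mul_le_mul (Real.sqrt_le_sqrt h2) ?_ (Real.sqrt_nonneg _) (Real.sqrt_nonneg _)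
    rw [Real.sqrt_le_left hr0]
    calc ∫ x, (φ n x - ψ x) ^ 2 ∂μ ≤ ∫ _, r n ^ 2 ∂μ := by
          refine integral_mono hd.integrable_sq (integrable_const _) fun x => ?_
          exact sq_le_sq' (by linarith [abs_le.1 (h3 x)]) (abs_le.1 (h3 x)).2
      _ = r n ^ 2 := by simp
  have := h0.add (h ψ hψ)
  rw [zero_add] at this
  refine this.congr fun n => ?_
  rw [← integral_add (integrable_mul_of_memLp (hf n) (g := fun x => φ n x - ψ x) ((hφ n).sub hψ))
    (integrable_mul_of_memLp (hf n) hψ)]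
  refine integral_congr_ae (Eventually.of_forall fun x => ?_)
  ring

end WeakConvergence

/-! ### Step functions and summation by parts. -/

section StepFunctions

theorem floor_div_eq {δ x : ℝ} (hδ : 0 < δ) {i : ℕ} (h1 : i * δ ≤ x) (h2 : x < (i + 1) * δ) :
    ⌊x / δ⌋₊ = i := by
  rw [Nat.floor_eq_iff (div_nonneg (le_trans (by positivity) h1) hδ.le)]
  exact ⟨(le_div_iff₀ hδ).2 h1, (div_lt_iff₀ hδ).2 h2⟩

theorem floor_div_mul_le {δ x : ℝ} (hδ : 0 < δ) (hx : 0 ≤ x) : ⌊x / δ⌋₊ * δ ≤ x := by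
  rw [← le_div_iff₀ hδ]
  exact Nat.floor_le (by positivity)

theorem lt_floor_div_add_one_mul {δ x : ℝ} (hδ : 0 < δ) : x < (⌊x / δ⌋₊ + 1) * δ := by
  rw [← div_lt_iff₀ hδ]
  exact Nat.lt_floor_add_one _

theorem floor_add_div {δ x : ℝ} (hδ : 0 < δ) (hx : 0 ≤ x) :
    ⌊(x + δ) / δ⌋₊ = ⌊x / δ⌋₊ + 1 := by
  rw [add_div, div_self hδ.ne', Nat.floor_add_one (by positivity)]

theorem measurable_floor_div (a : ℕ → ℝ) (δ : ℝ) : Measurable fun x : ℝ => a ⌊x / δ⌋₊ :=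
  (Measurable.of_discrete (f := a)).comp (Nat.measurable_floor.comp (measurable_id.div_const δ))

theorem intervalIntegral_cell (a : ℕ → ℝ) {δ : ℝ} (hδ : 0 < δ) (i : ℕ) :
    IntervalIntegrable (fun x => a ⌊x / δ⌋₊) volume (i * δ) ((i + 1 : ℕ) * δ) ∧
    ∫ x in (i * δ)..((i + 1 : ℕ) * δ), a ⌊x / δ⌋₊ = δ * a i := by
  have hle : (i : ℝ) * δ ≤ (i + 1 : ℕ) * δ := by push_cast; nlinarith
  have hae : ∀ᵐ x : ℝ, x ∈ uIoc ((i : ℝ) * δ) ((i + 1 : ℕ) * δ) → a i = a ⌊x / δ⌋₊ := by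
    have : ∀ᵐ x : ℝ, x ≠ (i + 1 : ℕ) * δ := by simp [ae_iff]
    filter_upwards [this] with x hx hx2
    rw [uIoc_of_le hle] at hx2
    have := lt_of_le_of_ne hx2.2 hx
    push_cast at this
    rw [floor_div_eq hδ hx2.1.le this]
  constructor
  · refine (intervalIntegrable_const (c := a i)).congr_ae ?_
    rwa [EventuallyEq, ae_restrict_iff' measurableSet_uIoc]
  · rw [← intervalIntegral.integral_congr_ae hae, intervalIntegral.integral_const, smul_eq_mul]
    push_cast; ring

theorem intervalIntegrable_floor (a : ℕ → ℝ) {δ : ℝ} (hδ : 0 < δ) (m : ℕ) :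
    IntervalIntegrable (fun x => a ⌊x / δ⌋₊) volume 0 (m * δ) := by
  have := IntervalIntegrable.trans_iterate (μ := volume) (f := fun x => a ⌊x / δ⌋₊)
    (a := fun k : ℕ => (k : ℝ) * δ) (n := m) fun k _ => (intervalIntegral_cell a hδ k).1
  simpa using this

theorem intervalIntegral_floor (a : ℕ → ℝ) {δ : ℝ} (hδ : 0 < δ) (m : ℕ) :
    ∫ x in (0 : ℝ)..(m * δ), a ⌊x / δ⌋₊ = δ * ∑ i ∈ Finset.range m, a i := by
  have := intervalIntegral.sum_integral_adjacent_intervals (μ := volume)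
    (f := fun x => a ⌊x / δ⌋₊)
    (a := fun k : ℕ => (k : ℝ) * δ) (n := m) fun k _ => (intervalIntegral_cell a hδ k).1
  simp only [Nat.cast_zero, zero_mul] at this
  rw [← this, Finset.mul_sum]
  exact Finset.sum_congr rfl fun i _ => (intervalIntegral_cell a hδ i).2

theorem measurable_stepFn (N : ℕ) (a : ℕ → ℝ) : Measurable (stepFn N a) :=
  measurable_floor_div a _

/-- Lebesgue measure on the unit interval. -/
abbrev unitVol : Measure ℝ := volume.restrict (Ioo 0 1)

instance : IsProbabilityMeasure unitVol := ⟨by simp [unitVol]⟩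

/-- The cell of index `N` starts at `x = 1`, so the last node does not enter. -/
theorem integral_stepFn {N : ℕ} (h2 : 2 ≤ N) (a : ℕ → ℝ) :
    ∫ x, stepFn N a x ∂unitVol = spacing N * ∑ i ∈ Finset.range N, a i := by
  rw [← intervalIntegral_floor a (spacing_pos h2) N, natCast_mul_spacing h2,
    intervalIntegral.integral_of_le zero_le_one, integral_Ioc_eq_integral_Ioo]
  rfl

theorem floor_lt_of_lt_one {N : ℕ} (h2 : 2 ≤ N) {x : ℝ} (hx : x < 1) : ⌊x / spacing N⌋₊ < N := by
  rw [Nat.floor_lt' (by omega), div_lt_iff₀ (spacing_pos h2), natCast_mul_spacing h2]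
  exact hx

theorem memLp_stepFn {N : ℕ} (h2 : 2 ≤ N) (a : ℕ → ℝ) (p : ENNReal) :
    MemLp (stepFn N a) p unitVol := by
  refine MemLp.of_bound (measurable_stepFn N a).aestronglyMeasurable
    (∑ i ∈ Finset.range N, |a i|) ?_
  filter_upwards [ae_restrict_mem measurableSet_Ioo] with x hx
  exact Finset.single_le_sum (f := fun i => |a i|) (fun _ _ => abs_nonneg _)
    (Finset.mem_range.2 (floor_lt_of_lt_one h2 hx.2))

theorem integral_stepFn_sq {N : ℕ} (h2 : 2 ≤ N) (a : ℕ → ℝ) :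
    ∫ x, stepFn N a x ^ 2 ∂unitVol = ∑ i ∈ Finset.range N, spacing N * a i ^ 2 := by
  rw [← Finset.mul_sum, ← integral_stepFn h2 (fun i => a i ^ 2)]
  rfl

theorem integrable_stepFn_mul {N : ℕ} {a : ℕ → ℝ} {B : ℝ} (ha : ∀ i, |a i| ≤ B) {φ : ℝ → ℝ}
    (hφ : Integrable φ) : Integrable fun x => stepFn N a x * φ x :=
  hφ.bdd_mul (measurable_stepFn N a).aestronglyMeasurable
    (Eventually.of_forall fun _ => ha _)

/-- A translation by one cell. The natural-number floor is `0` at negative arguments and does not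
commute with the shift there, so `φ` has to vanish on that side. -/
theorem integral_stepFn_succ_mul {N : ℕ} (h2 : 2 ≤ N) (a : ℕ → ℝ) {φ : ℝ → ℝ}
    (hφ : ∀ x < 0, φ x = 0) :
    ∫ x, stepFn N (fun i => a (i + 1)) x * φ x = ∫ x, stepFn N a x * φ (x - spacing N) := by
  rw [← integral_add_right_eq_self (fun x => stepFn N a x * φ (x - spacing N)) (spacing N)]
  refine integral_congr_ae (Eventually.of_forall fun x => ?_)
  simp only [add_sub_cancel_right]
  rcases lt_or_ge x 0 with hx | hx
  · simp [hφ x hx]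
  · simp only [stepFn, floor_add_div (spacing_pos h2) hx]

/-- Discrete integration by parts, the difference being put to the left on the test function. -/
theorem integral_stepFn_diff_mul {N : ℕ} (h2 : 2 ≤ N) {a : ℕ → ℝ} {B : ℝ} (ha : ∀ i, |a i| ≤ B)
    {φ : ℝ → ℝ} (hφi : Integrable φ) (hφ : ∀ x < 0, φ x = 0) :
    ∫ x, stepFn N (fun i => a (i + 1) - a i) x * φ x =
      ∫ x, stepFn N a x * (φ (x - spacing N) - φ x) := by
  simp only [mul_sub]
  rw [integral_sub (integrable_stepFn_mul ha (hφi.comp_sub_right _))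
    (integrable_stepFn_mul ha hφi), ← integral_stepFn_succ_mul h2 a hφ,
    ← integral_sub (integrable_stepFn_mul (fun i => ha (i + 1)) hφi)
    (integrable_stepFn_mul ha hφi)]
  simp only [stepFn, sub_mul]

/-- Discrete integration by parts, the difference being put to the right on the test function. -/
theorem integral_stepFn_diff_mul' {N : ℕ} (h2 : 2 ≤ N) {a : ℕ → ℝ} {B : ℝ} (ha : ∀ i, |a i| ≤ B)
    {φ : ℝ → ℝ} (hφi : Integrable φ) (hφ : ∀ x < spacing N, φ x = 0) :
    ∫ x, stepFn N (fun i => a (i + 1) - a i) x * φ x =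
      ∫ x, stepFn N (fun i => a (i + 1)) x * (φ x - φ (x + spacing N)) := by
  have h1 := integral_stepFn_succ_mul h2 a (φ := fun x => φ (x + spacing N))
    (fun x hx => hφ _ (by linarith))
  simp only [sub_add_cancel] at h1
  have ha' : ∀ i, |a (i + 1)| ≤ B := fun i => ha _
  simp only [mul_sub]
  rw [integral_sub (integrable_stepFn_mul ha' hφi)
    (integrable_stepFn_mul ha' (hφi.comp_add_right _)), h1,
    ← integral_sub (integrable_stepFn_mul ha' hφi) (integrable_stepFn_mul ha hφi)]
  simp only [stepFn, sub_mul]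

end StepFunctions

/-! ### Difference quotients of test functions. -/

section DifferenceQuotients

/-- The mean value inequality for `y ↦ f y - y f'(x)`, whose derivative is at most `K|h|` between
`x` and `x + h`. -/
theorem abs_sub_sub_mul_deriv_le {f : ℝ → ℝ} (hf : Differentiable ℝ f) {K : ℝ} (hK : 0 ≤ K)
    (hlip : ∀ x y, |deriv f x - deriv f y| ≤ K * |x - y|) (x h : ℝ) :
    |f (x + h) - f x - h * deriv f x| ≤ K * h ^ 2 := by
  have := Convex.norm_image_sub_le_of_norm_hasDerivWithin_le
    (f := fun y => f y - y * deriv f x) (f' := fun y => deriv f y - deriv f x)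
    (s := uIcc x (x + h)) (x := x) (y := x + h) (C := K * |h|)
    (fun y _ => by
      have := ((hf y).hasDerivAt.fun_sub ((hasDerivAt_id' y).mul_const (deriv f x)))
      simpa using this.hasDerivWithinAt)
    (fun y hy => by
      refine (hlip y x).trans (mul_le_mul_of_nonneg_left ?_ hK)
      have := abs_sub_left_of_mem_uIcc hy
      simpa using this)
    (convex_uIcc _ _) left_mem_uIcc right_mem_uIcc
  simp only [Real.norm_eq_abs, add_sub_cancel_left] at this
  have e : f (x + h) - (x + h) * deriv f x - (f x - x * deriv f x) =
    f (x + h) - f x - h * deriv f x := by ring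
  rw [e, mul_assoc, ← abs_mul, ← pow_two, abs_of_nonneg (sq_nonneg h)] at this
  exact this

theorem exists_lipschitz_deriv {f : ℝ → ℝ} (hf : ContDiff ℝ ∞ f) (hc : HasCompactSupport f) :
    ∃ K, 0 ≤ K ∧ ∀ x y, |deriv f x - deriv f y| ≤ K * |x - y| := by
  have h1 : ContDiff ℝ 1 (deriv f) := by
    have := (contDiff_infty_iff_deriv.1 hf).2
    exact this.of_le (by exact_mod_cast le_top)
  obtain ⟨K, hK⟩ := ContDiff.lipschitzWith_of_hasCompactSupport hc.deriv h1 one_ne_zero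
  exact ⟨K, K.2, fun x y => by simpa [Real.dist_eq] using hK.dist_le_mul x y⟩

end DifferenceQuotients

/-! ### Piecewise `H¹` limits and identification of the weak limit of the fluxes. -/

theorem integral_unitVol_eq {g : ℝ → ℝ} (h : ∀ x ∉ Ioo (0 : ℝ) 1, g x = 0) :
    ∫ x, g x ∂unitVol = ∫ x, g x :=
  setIntegral_eq_integral_of_forall_compl_eq_zero h

theorem setIntegral_diff_finset (P : Finset ℝ) (g : ℝ → ℝ) :
    ∫ x in Ioo 0 1 \ (P : Set ℝ), g x = ∫ x, g x ∂unitVol :=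
  setIntegral_congr_set (sdiff_null_ae_eq_self (P.finite_toSet.measure_zero _))

theorem exists_margin {φ : ℝ → ℝ} (hc : HasCompactSupport φ) (hs : tsupport φ ⊆ Ioo 0 1) :
    ∃ δ > 0, ∀ x, φ x ≠ 0 → δ < x ∧ x < 1 - δ := by
  obtain ⟨δ, hδ, hsub⟩ := hc.exists_thickening_subset_open isOpen_Ioo hs
  refine ⟨δ / 2, by positivity, fun x hx => ?_⟩
  have hx' : x ∈ tsupport φ := subset_tsupport _ hx
  have h1 : x - δ / 2 ∈ Ioo (0 : ℝ) 1 := hsub (Metric.mem_thickening_iff.2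
    ⟨x, hx', by rw [Real.dist_eq, abs_lt]; constructor <;> linarith⟩)
  have h2 : x + δ / 2 ∈ Ioo (0 : ℝ) 1 := hsub (Metric.mem_thickening_iff.2
    ⟨x, hx', by rw [Real.dist_eq, abs_lt]; constructor <;> linarith⟩)
  exact ⟨by linarith [h1.1], by linarith [h2.2]⟩

theorem memLp_unitVol_of_continuous {φ : ℝ → ℝ} (h : Continuous φ) (hc : HasCompactSupport φ) :
    MemLp φ 2 unitVol :=
  (h.memLp_of_hasCompactSupport hc).restrict _

/-- Test functions supported off both exceptional sets are admissible for `g` and `g'`, and the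
union of these sets is null. -/
theorem isWeakDeriv_unique {f g g' : ℝ → ℝ} (hg : IsPiecewiseH1With f g)
    (hg' : IsPiecewiseH1With f g') : g =ᵐ[unitVol] g' := by
  obtain ⟨-, hg2, P, hP⟩ := hg
  obtain ⟨-, hg2', P', hP'⟩ := hg'
  have hi : Integrable (fun x => g x - g' x) unitVol :=
    (hg2.sub hg2').integrable one_le_two
  have hU : IsOpen (Ioo (0 : ℝ) 1 \ ((P ∪ P' : Finset ℝ) : Set ℝ)) :=
    isOpen_Ioo.sdiff (Finset.finite_toSet _).isClosed
  have key := hU.ae_eq_zero_of_integral_contDiff_smul_eq_zero (μ := unitVol)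
    (f := fun x => g x - g' x) (hi.locallyIntegrable.locallyIntegrableOn _) (by
      intro φ hφ hc hs
      have hs1 : tsupport φ ⊆ Ioo (0 : ℝ) 1 \ (P : Set ℝ) := hs.trans (by
        intro x hx; exact ⟨hx.1, fun h => hx.2 (by simp [Finset.mem_coe.1 h])⟩)
      have hs2 : tsupport φ ⊆ Ioo (0 : ℝ) 1 \ (P' : Set ℝ) := hs.trans (by
        intro x hx; exact ⟨hx.1, fun h => hx.2 (by simp [Finset.mem_coe.1 h])⟩)
      have e1 := hP φ hφ hc hs1
      have e2 := hP' φ hφ hc hs2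
      rw [setIntegral_diff_finset, setIntegral_diff_finset] at e1 e2
      have hφ2 := memLp_unitVol_of_continuous hφ.continuous hc
      have : ∫ x, (g x - g' x) * φ x ∂unitVol = 0 := by
        simp only [sub_mul]
        rw [integral_sub (integrable_mul_of_memLp hg2 hφ2) (integrable_mul_of_memLp hg2' hφ2)]
        linarith
      simpa only [smul_eq_mul, mul_comm] using this)
  have h0 : ∀ᵐ x ∂unitVol, x ∉ ((P ∪ P' : Finset ℝ) : Set ℝ) :=
    ae_restrict_of_ae (compl_mem_ae_iff.2 ((Finset.finite_toSet _).measure_zero _))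
  filter_upwards [key, h0, ae_restrict_mem measurableSet_Ioo] with x h1 h2 h3
  exact sub_eq_zero.1 (h1 ⟨h3, h2⟩)

/-- Padding with `0` gives enumerations of a fixed length `k`, so that the bond positions for all
`n` lie in one compact cube. -/
theorem exists_enum (s : Finset ℕ) {k : ℕ} (h : s.card ≤ k) :
    ∃ e : Fin k → ℕ, (∀ i ∈ s, ∃ j, e j = i) ∧ ∀ j, e j ∈ s ∨ e j = 0 := by
  refine ⟨fun j => if hj : (j : ℕ) < s.card then (s.equivFin.symm ⟨j, hj⟩ : ℕ) else 0,
    fun i hi => ?_, fun j => ?_⟩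
  · refine ⟨⟨s.equivFin ⟨i, hi⟩, (s.equivFin ⟨i, hi⟩).2.trans_le h⟩, ?_⟩
    simp
  · by_cases hj : (j : ℕ) < s.card
    · left; simp [hj]
    · right; simp [hj]

/-- Along an ultrafilter, the large bonds concentrate at finitely many points. -/
theorem exists_concentration_points {N : ℕ → ℕ} (hN2 : ∀ n, 2 ≤ N n) (hN : Tendsto N atTop atTop)
    {V : (n : ℕ) → Fin (N n + 1) → ℝ} {M : ℝ} (hM : ∀ n, energy (N n) (V n) ≤ M)
    {𝒰 : Ultrafilter ℕ} (h𝒰 : (𝒰 : Filter ℕ) ≤ atTop) :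
    ∃ P : Finset ℝ, ∀ K : Set ℝ, IsClosed K → K ⊆ Ici 0 → Disjoint K (P : Set ℝ) →
      ∀ᶠ n in 𝒰, ∀ x ∈ K, ⌊x / spacing (N n)⌋₊ ∉ largeBonds (N n) (V n) := by
  set k := ⌊2 * M⌋₊
  have hcard : ∀ᶠ n in 𝒰, (largeBonds (N n) (V n)).card ≤ k := by
    filter_upwards [h𝒰 (hN.eventually_ge_atTop 3)] with n hn
    exact Nat.le_floor (card_largeBonds_le hn (hM n))
  have hex : ∀ n, ∃ e : Fin k → ℕ, ((largeBonds (N n) (V n)).card ≤ k →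
      ∀ i ∈ largeBonds (N n) (V n), ∃ j, e j = i) ∧ ∀ j, e j ≤ N n := by
    intro n
    by_cases h : (largeBonds (N n) (V n)).card ≤ k
    · obtain ⟨e, h1, h2⟩ := exists_enum _ h
      refine ⟨e, fun _ => h1, fun j => ?_⟩
      rcases h2 j with h | h
      · exact (Finset.mem_range.1 (Finset.mem_filter.1 h).1).le
      · omega
    · exact ⟨fun _ => 0, fun h' => absurd h' h, fun _ => Nat.zero_le _⟩
  choose e he1 he2 using hex
  let p : ℕ → Fin k → ℝ := fun n j => e n j * spacing (N n)
  have hp : ∀ n, p n ∈ Icc (0 : Fin k → ℝ) 1 := by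
    intro n
    have hε := spacing_pos (hN2 n)
    refine ⟨fun j => by simp only [p, Pi.zero_apply]; positivity, fun j => ?_⟩
    simp only [p, Pi.one_apply]
    rw [← natCast_mul_spacing (hN2 n)]
    exact mul_le_mul_of_nonneg_right (by exact_mod_cast he2 n j) hε.le
  -- The coordinates of the limit `q` are the concentration points. Padding entries can at most add
  -- the harmless point `0`.
  obtain ⟨q, -, hq⟩ := (isCompact_Icc (a := (0 : Fin k → ℝ)) (b := 1)).ultrafilter_le_nhds'
    (𝒰.map p) (by rw [Ultrafilter.mem_map]; exact univ_mem' hp)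
  have hq' : Tendsto p 𝒰 (𝓝 q) := hq
  rw [tendsto_pi_nhds] at hq'
  refine ⟨Finset.univ.image q, fun K hK hK0 hd => ?_⟩
  have hball : ∀ j, ∃ r > 0, ∀ x ∈ K, r ≤ |x - q j| := by
    intro j
    have hj : q j ∉ K := fun h => disjoint_left.1 hd h (by simp)
    obtain ⟨r, hr, hsub⟩ := Metric.isOpen_iff.1 hK.isOpen_compl (q j) hj
    exact ⟨r, hr, fun x hx => not_lt.1 fun h => hsub (by simpa [Real.dist_eq] using h) hx⟩
  choose r hr0 hr using hball
  have h1 : ∀ᶠ n in 𝒰, ∀ j, |p n j - q j| < r j / 2 := by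
    rw [eventually_all]
    intro j
    have := (Metric.tendsto_nhds.1 (hq' j)) (r j / 2) (half_pos (hr0 j))
    simpa only [Real.dist_eq] using this
  have h2 : ∀ᶠ n in 𝒰, ∀ j, spacing (N n) < r j / 2 := by
    rw [eventually_all]
    intro j
    exact h𝒰 ((tendsto_spacing hN).eventually (gt_mem_nhds (half_pos (hr0 j))))
  filter_upwards [h1, h2, hcard] with n h3 h4 h5 x hx hmem
  obtain ⟨j, hj⟩ := he1 n h5 _ hmem
  have hε := spacing_pos (hN2 n)
  have a1 := floor_div_mul_le hε (hK0 hx)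
  have a2 := lt_floor_div_add_one_mul (x := x) hε
  have a3 : p n j = ⌊x / spacing (N n)⌋₊ * spacing (N n) := by simp only [p, hj]
  have a4 := hr j x hx
  have a5 := abs_lt.1 (h3 j)
  have a6 := h4 j
  rw [a3] at a5
  rw [le_abs] at a4
  -- The left end of a large bond is within `r/2` of `q j`, and `x` within `ε < r/2` of that end,
  -- against `|x - q j| ≥ r`.
  rcases a4 with a4 | a4 <;> nlinarith

theorem abs_nodal_le {N : ℕ} {v : Fin (N + 1) → ℝ} {C : ℝ} (h : ∀ i, |v i| ≤ C) (i : ℕ) :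
    |nodal N v i| ≤ C := h _

theorem memLp_interp {N : ℕ} (h2 : 2 ≤ N) (v : Fin (N + 1) → ℝ) (p : ENNReal) :
    MemLp (interp N v) p unitVol :=
  memLp_stepFn h2 (nodal N v) p

theorem integral_interp_sq_le {N : ℕ} {v : Fin (N + 1) → ℝ} {C : ℝ} (h : ∀ i, |v i| ≤ C) :
    ∫ x, interp N v x ^ 2 ∂unitVol ≤ C ^ 2 := by
  calc ∫ x, interp N v x ^ 2 ∂unitVol ≤ ∫ _, C ^ 2 ∂unitVol := by
        refine integral_mono_of_nonneg (Eventually.of_forall fun _ => sq_nonneg _)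
          (integrable_const _) (Eventually.of_forall fun x => ?_)
        exact sq_le_sq' (abs_le.1 (h _)).1 (abs_le.1 (h _)).2
    _ = C ^ 2 := by simp

/-- The discrete flux represents the derivative away from the large bonds. -/
theorem abs_integral_interp_add_flux_le {N : ℕ} (h2 : 2 ≤ N) {v : Fin (N + 1) → ℝ} {M C : ℝ}
    (hM : energy N v ≤ M) (hC : ∀ i, |v i| ≤ C) {φ : ℝ → ℝ} (hφ : Continuous φ)
    (hc : HasCompactSupport φ) (hsupp : ∀ x, φ x ≠ 0 → 0 < x ∧ x < 1 - spacing N) {B : ℝ}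
    (hB : ∀ x, |φ x| ≤ B)
    (hlarge : ∀ x, φ x ≠ 0 → ⌊x / spacing N⌋₊ ∉ largeBonds N v) :
    |∫ x, interp N v x * ((φ (x - spacing N) - φ x) / spacing N) ∂unitVol -
      1 / 2 * ∫ x, stepFn N (bondFlux N v) x * φ x ∂unitVol| ≤
      B * (√√(spacing N) * logSpacing N * M) := by
  have hε := spacing_pos h2
  have hφi : Integrable φ := hφ.integrable_of_hasCompactSupport hc
  have hφ2 := memLp_unitVol_of_continuous hφ hc
  have hz : ∀ x ∉ Ioo (0 : ℝ) 1, φ x = 0 := by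
    intro x hx
    by_contra h
    exact hx ⟨(hsupp x h).1, by linarith [(hsupp x h).2]⟩
  have hz0 : ∀ x < 0, φ x = 0 := fun x hx => hz x fun h => by linarith [h.1]
  have hB0 : 0 ≤ B := (abs_nonneg _).trans (hB 0)
  set ρ : ℕ → ℝ := fun i => excess N (incr N v i) / (1 + excess N (incr N v i)) with hρ
  have hρ0 : ∀ i, 0 ≤ ρ i := fun i => by
    have := excess_nonneg N (incr N v i)
    simp only [hρ]; positivity
  have e1 : ∫ x, interp N v x * ((φ (x - spacing N) - φ x) / spacing N) ∂unitVol =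
      ∫ x, stepFn N (fun i => incr N v i / spacing N) x * φ x ∂unitVol := by
    rw [integral_unitVol_eq, integral_unitVol_eq]
    · have := integral_stepFn_diff_mul h2 (abs_nodal_le hC) hφi hz0
      have h3 := congrArg (fun y => y / spacing N) this
      simp only [← integral_div] at h3
      rw [interp_eq_stepFn]
      refine Eq.trans ?_ (h3.symm.trans ?_)
      · exact integral_congr_ae (Eventually.of_forall fun x => (mul_div_assoc _ _ _).symm)
      · refine integral_congr_ae (Eventually.of_forall fun x => ?_)
        simp only [stepFn, incr]; ring
    · intro x hx; rw [hz x hx, mul_zero]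
    · intro x hx
      have : φ (x - spacing N) = 0 := by
        by_contra h
        obtain ⟨h3, h4⟩ := hsupp _ h
        exact hx ⟨by linarith, by linarith⟩
      rw [hz x hx, this]; simp
  have e2 : ∫ x, stepFn N (fun i => incr N v i / spacing N) x * φ x ∂unitVol -
      1 / 2 * ∫ x, stepFn N (bondFlux N v) x * φ x ∂unitVol =
      ∫ x, stepFn N (fun i => incr N v i / spacing N * ρ i) x * φ x ∂unitVol := by
    rw [← integral_const_mul, ← integral_sub (integrable_mul_of_memLp (memLp_stepFn h2 _ _) hφ2)
      ((integrable_mul_of_memLp (memLp_stepFn h2 _ _) hφ2).const_mul _)]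
    refine integral_congr_ae (Eventually.of_forall fun x => ?_)
    simp only [stepFn]
    set i := ⌊x / spacing N⌋₊
    have h := incr_decomp h2 (incr N v i)
    have h' : incr N v i / spacing N = bondFlux N v i / 2 + incr N v i / spacing N * ρ i := by
      simp only [bondFlux, hρ]
      field_simp
      field_simp at h
      linarith
    calc _ = (incr N v i / spacing N - bondFlux N v i / 2) * φ x := by ring
      _ = _ := by rw [sub_eq_iff_eq_add'.2 h']
  rw [e1, e2]
  -- Where `φ` is nonzero there are no large bonds, so the increment is at most `ε^(1/4)`; the
  -- weights `ρ` sum to at most `L M`.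
  have e3 : ∀ x, |stepFn N (fun i => incr N v i / spacing N * ρ i) x * φ x| ≤
      stepFn N (fun i => B * √√(spacing N) / spacing N * ρ i) x := by
    intro x
    simp only [stepFn]
    by_cases hx : φ x = 0
    · rw [hx, mul_zero, abs_zero]
      have := hρ0 ⌊x / spacing N⌋₊
      positivity
    · have h3 := abs_incr_le_of_notMem (hlarge x hx)
      rw [abs_mul, abs_mul, abs_div, abs_of_pos hε, abs_of_nonneg (hρ0 _)]
      calc _ ≤ √√(spacing N) / spacing N * ρ ⌊x / spacing N⌋₊ * B := by
            have := hρ0 ⌊x / spacing N⌋₊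
            gcongr
            exact hB x
        _ = _ := by ring
  refine (abs_integral_le_integral_abs).trans ?_
  calc _ ≤ ∫ x, stepFn N (fun i => B * √√(spacing N) / spacing N * ρ i) x ∂unitVol :=
        integral_mono_of_nonneg (Eventually.of_forall fun _ => abs_nonneg _)
          ((memLp_stepFn h2 _ 1).integrable le_rfl) (Eventually.of_forall e3)
    _ = B * √√(spacing N) * ∑ i ∈ Finset.range N, ρ i := by
        rw [integral_stepFn h2, ← Finset.mul_sum]; field_simp
    _ ≤ B * √√(spacing N) * (logSpacing N * M) := by
        gcongr; exact sum_excess_le h2 hM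
    _ = _ := by ring

/-- The limit of `abs_integral_interp_add_flux_le`: backward difference quotients of `φ` converge
uniformly to `-φ'`, and the error is of order `ε^(1/4) L`. -/
theorem integral_mul_deriv_eq_of_weakTendsto {N : ℕ → ℕ} (hN2 : ∀ n, 2 ≤ N n)
    (hN : Tendsto N atTop atTop)
    {V : (n : ℕ) → Fin (N n + 1) → ℝ} {M C : ℝ} (hM : ∀ n, energy (N n) (V n) ≤ M)
    (hC : ∀ n i, |V n i| ≤ C) {f : ℝ → ℝ} {l : Filter ℕ} [NeBot l] (hl : l ≤ atTop)
    (hf : WeakTendsto unitVol (fun n => interp (N n) (V n)) l f) {Z : ℝ → ℝ}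
    (hZ : WeakTendsto unitVol (fun n => stepFn (N n) (bondFlux (N n) (V n))) l Z)
    {φ : ℝ → ℝ} (hφ : ContDiff ℝ ∞ φ) (hc : HasCompactSupport φ) (hs : tsupport φ ⊆ Ioo 0 1)
    (hlarge : ∀ᶠ n in l, ∀ x ∈ tsupport φ,
      ⌊x / spacing (N n)⌋₊ ∉ largeBonds (N n) (V n)) :
    ∫ x, f x * deriv φ x ∂unitVol = - ∫ x, (1 / 2 * Z x) * φ x ∂unitVol := by
  obtain ⟨δ, hδ, hm⟩ := exists_margin hc hs
  obtain ⟨B, hB⟩ := hc.exists_bound_of_continuous hφ.continuous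
  obtain ⟨K, hK0, hK⟩ := exists_lipschitz_deriv hφ hc
  have hε0 := (tendsto_spacing hN).mono_left hl
  have hφ' : Continuous (deriv φ) := hφ.continuous_deriv (by simp)
  have hφ2 := memLp_unitVol_of_continuous hφ.continuous hc
  have hdq : ∀ n, Continuous fun x => (φ (x - spacing (N n)) - φ x) / spacing (N n) := fun n =>
    ((hφ.continuous.comp (continuous_id.sub continuous_const)).sub hφ.continuous).div_const _
  have h1 : Tendsto (fun n => ∫ x, interp (N n) (V n) x *
      ((φ (x - spacing (N n)) - φ x) / spacing (N n)) ∂unitVol) l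
      (𝓝 (∫ x, f x * (-deriv φ x) ∂unitVol)) := by
    refine hf.integral_mul_of_uniform (fun n => memLp_interp (hN2 n) _ _) (B := C ^ 2)
      (Eventually.of_forall fun n => integral_interp_sq_le (hC n)) (fun n => ?_) ?_
      (r := fun n => K * spacing (N n)) (by simpa using hε0.const_mul K)
      (Eventually.of_forall fun n x => ?_)
    · refine memLp_unitVol_of_continuous (hdq n) ?_
      have h : HasCompactSupport fun x => φ (x - spacing (N n)) := by
        simpa [Function.comp_def] using hc.comp_homeomorph (Homeomorph.subRight (spacing (N n)))
      have := (h.sub hc).mul_right (f' := fun _ => (spacing (N n))⁻¹)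
      simp only [div_eq_mul_inv]
      exact this
    · exact (memLp_unitVol_of_continuous hφ' hc.deriv).neg
    · have hε := spacing_pos (hN2 n)
      have := abs_sub_sub_mul_deriv_le (hφ.differentiable (by simp)) hK0 hK x (-spacing (N n))
      have e : (φ (x - spacing (N n)) - φ x) / spacing (N n) - -deriv φ x =
        (φ (x + -spacing (N n)) - φ x - -spacing (N n) * deriv φ x) / spacing (N n) := by
        rw [← sub_eq_add_neg]; field_simp
      rw [e, abs_div, abs_of_pos hε, div_le_iff₀ hε]
      linarith
  have h2 : Tendsto (fun n => ∫ x, interp (N n) (V n) x *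
      ((φ (x - spacing (N n)) - φ x) / spacing (N n)) ∂unitVol -
      1 / 2 * ∫ x, stepFn (N n) (bondFlux (N n) (V n)) x * φ x ∂unitVol) l (𝓝 0) := by
    have h3 : Tendsto (fun n => B * (√√(spacing (N n)) * logSpacing (N n) * M)) l (𝓝 0) := by
      simpa using
        (((tendsto_sqrt_sqrt_spacing_mul_logSpacing hN).mono_left hl).mul_const M).const_mul B
    refine squeeze_zero_norm' ?_ h3
    filter_upwards [hlarge, hε0.eventually (gt_mem_nhds hδ)] with n h4 h5
    refine abs_integral_interp_add_flux_le (hN2 n) (hM n) (hC n) hφ.continuous hc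
      (fun x hx => ?_) hB fun x hx => h4 x (subset_tsupport _ hx)
    have := hm x hx
    exact ⟨by linarith, by linarith⟩
  have h3 := h1.sub ((hZ φ hφ2).const_mul (1 / 2))
  have h4 := tendsto_nhds_unique h2 h3
  simp only [mul_neg, integral_neg] at h4
  simp only [mul_assoc, integral_const_mul]
  linarith

theorem integral_stepFn_bondFlux_sq_le {N : ℕ} (h2 : 2 ≤ N) {v : Fin (N + 1) → ℝ} {M : ℝ}
    (hM : energy N v ≤ M) : ∫ x, stepFn N (bondFlux N v) x ^ 2 ∂unitVol ≤ 4 * M := by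
  rw [integral_stepFn_sq h2]
  exact sum_flux_sq_le h2 hM

/-- The `L²`-limit of lattice functions of bounded energy is piecewise `H¹`, and the discrete
fluxes converge weakly to twice its derivative. -/
theorem exists_piecewise_deriv {N : ℕ → ℕ} (hN2 : ∀ n, 2 ≤ N n) (hN : Tendsto N atTop atTop)
    {V : (n : ℕ) → Fin (N n + 1) → ℝ} {M C : ℝ} (hM : ∀ n, energy (N n) (V n) ≤ M)
    (hC : ∀ n i, |V n i| ≤ C) {f : ℝ → ℝ} (hf2 : MemLp f 2 unitVol)
    (hf : WeakTendsto unitVol (fun n => interp (N n) (V n)) atTop f) :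
    ∃ g, ∫ x, g x ^ 2 ∂unitVol ≤ M ∧ IsPiecewiseH1With f g ∧
      WeakTendsto unitVol (fun n => stepFn (N n) (bondFlux (N n) (V n))) atTop
        (fun x => 2 * g x) := by
  have key : ∀ 𝒰 : Ultrafilter ℕ, (𝒰 : Filter ℕ) ≤ atTop → ∃ Z, MemLp Z 2 unitVol ∧
      ∫ x, Z x ^ 2 ∂unitVol ≤ 4 * M ∧
      WeakTendsto unitVol (fun n => stepFn (N n) (bondFlux (N n) (V n))) 𝒰 Z ∧
      IsPiecewiseH1With f (fun x => 1 / 2 * Z x) := by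
    intro 𝒰 h𝒰
    obtain ⟨Z, hZ2, hZM, hZ⟩ := exists_weakTendsto 𝒰
      (fun n => memLp_stepFn (hN2 n) (bondFlux (N n) (V n)) 2)
      (Eventually.of_forall fun n => integral_stepFn_bondFlux_sq_le (hN2 n) (hM n))
    obtain ⟨P, hP⟩ := exists_concentration_points hN2 hN hM h𝒰
    refine ⟨Z, hZ2, hZM, hZ, hf2, hZ2.const_mul _, P, fun φ hφ hc hs => ?_⟩
    rw [setIntegral_diff_finset, setIntegral_diff_finset]
    refine integral_mul_deriv_eq_of_weakTendsto hN2 hN hM hC h𝒰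
      (fun ψ hψ => (hf ψ hψ).mono_left h𝒰) hZ hφ hc (fun x hx => (hs hx).1) ?_
    exact hP _ (isClosed_tsupport _) (fun x hx => (hs hx).1.1.le)
      (disjoint_left.2 fun x hx => (hs hx).2)
  obtain ⟨Z, hZ2, hZM, hZ, hZd⟩ := key (Ultrafilter.of atTop) (Ultrafilter.of_le _)
  refine ⟨fun x => 1 / 2 * Z x, ?_, hZd, fun φ hφ => ?_⟩
  · simp only [mul_pow, integral_const_mul]
    linarith
  -- Half the limit along any ultrafilter is a piecewise derivative of the same `f`, so uniqueness
  -- makes all these limits agree and the full sequence converges.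
  · rw [tendsto_iff_ultrafilter]
    intro 𝒰 h𝒰
    obtain ⟨Z', hZ2', -, hZ', hZd'⟩ := key 𝒰 h𝒰
    have e : ∫ x, 2 * (1 / 2 * Z x) * φ x ∂unitVol = ∫ x, Z' x * φ x ∂unitVol := by
      refine integral_congr_ae ?_
      filter_upwards [isWeakDeriv_unique hZd hZd'] with x hx
      rw [show Z' x = 2 * (1 / 2 * Z' x) by ring, ← hx]
    rw [e]
    exact hZ' φ hφ

/-! ### Flux difference quotients and their primitives. -/

/-- The difference quotient of the discrete flux at a node. -/
def fluxDiff (N : ℕ) (v : Fin (N + 1) → ℝ) (i : ℕ) : ℝ :=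
  (nodalFlux N v (i + 1) - nodalFlux N v i) / spacing N

/-- The squared norm of the difference quotients of the flux. -/
def dissipation (N : ℕ) (v : Fin (N + 1) → ℝ) : ℝ :=
  ∑ i ∈ Finset.range (N + 1), spacing N * fluxDiff N v i ^ 2

theorem intervalIntegral_eq_unitVol {w : ℝ → ℝ} {a b : ℝ} (ha : 0 ≤ a) (hab : a ≤ b)
    (hb : b ≤ 1) :
    ∫ x in a..b, w x = ∫ x, w x * (Ioo a b).indicator 1 x ∂unitVol := by
  rw [intervalIntegral.integral_of_le hab, integral_Ioc_eq_integral_Ioo]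
  have : (fun x => w x * (Ioo a b).indicator 1 x) = (Ioo a b).indicator w := by
    funext x
    by_cases hx : x ∈ Ioo a b <;> simp [hx]
  rw [this, integral_indicator measurableSet_Ioo, unitVol,
    Measure.restrict_restrict measurableSet_Ioo, inter_eq_left.2 (Ioo_subset_Ioo ha hb)]

theorem memLp_indicator_Ioo (a b : ℝ) : MemLp ((Ioo a b).indicator 1 : ℝ → ℝ) 2 unitVol :=
  memLp_indicator_const 2 measurableSet_Ioo (1 : ℝ) (Or.inr (measure_ne_top _ _))

theorem intervalIntegrable_of_memLp {w : ℝ → ℝ} (hw : MemLp w 2 unitVol) {a b : ℝ}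
    (ha : a ∈ Icc (0 : ℝ) 1) (hb : b ∈ Icc (0 : ℝ) 1) : IntervalIntegrable w volume a b := by
  have h1 : IntegrableOn w (Icc 0 1) :=
    (integrableOn_Icc_iff_integrableOn_Ioo (by simp) (by simp)).2 (hw.integrable one_le_two)
  exact (h1.mono_set (uIcc_subset_Icc ha hb)).intervalIntegrable

/-- Cauchy–Schwarz against an indicator: primitives of an `L²`-bounded family are equi-Hölder with
exponent `1/2`. -/
theorem abs_intervalIntegral_le {w : ℝ → ℝ} (hw : MemLp w 2 unitVol) {R : ℝ}
    (hR : ∫ x, w x ^ 2 ∂unitVol ≤ R) {a b : ℝ} (ha : a ∈ Icc (0 : ℝ) 1) (hb : b ∈ Icc (0 : ℝ) 1) :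
    |∫ x in a..b, w x| ≤ √(R * |b - a|) := by
  wlog hab : a ≤ b generalizing a b
  · rw [intervalIntegral.integral_symm, abs_neg, abs_sub_comm]
    exact this hb ha (le_of_not_ge hab)
  rw [intervalIntegral_eq_unitVol ha.1 hab hb.2, abs_of_nonneg (sub_nonneg.2 hab),
    Real.sqrt_mul' _ (sub_nonneg.2 hab)]
  refine (abs_integral_mul_le hw (memLp_indicator_Ioo a b)).trans ?_
  gcongr
  have : (fun x => (Ioo a b).indicator (1 : ℝ → ℝ) x ^ 2) = (Ioo a b).indicator 1 := by
    funext x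
    by_cases hx : x ∈ Ioo a b <;> simp [hx]
  rw [this, integral_indicator_one measurableSet_Ioo, measureReal_def, unitVol,
    Measure.restrict_apply measurableSet_Ioo, inter_eq_left.2 (Ioo_subset_Ioo ha.1 hb.2),
    Real.volume_Ioo, ENNReal.toReal_ofReal (sub_nonneg.2 hab)]

theorem abs_intervalIntegral_sub_le {w : ℝ → ℝ} (hw : MemLp w 2 unitVol) {R : ℝ}
    (hR : ∫ x, w x ^ 2 ∂unitVol ≤ R) {a b : ℝ} (ha : a ∈ Icc (0 : ℝ) 1) (hb : b ∈ Icc (0 : ℝ) 1) :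
    |(∫ x in (0 : ℝ)..b, w x) - ∫ x in (0 : ℝ)..a, w x| ≤ √(R * |b - a|) := by
  have h0 : (0 : ℝ) ∈ Icc (0 : ℝ) 1 := ⟨le_rfl, zero_le_one⟩
  rw [intervalIntegral.integral_interval_sub_left (intervalIntegrable_of_memLp hw h0 hb)
    (intervalIntegrable_of_memLp hw h0 ha)]
  exact abs_intervalIntegral_le hw hR ha hb

theorem WeakTendsto.intervalIntegral {w : ℕ → ℝ → ℝ} {l : Filter ℕ} {W : ℝ → ℝ}
    (h : WeakTendsto unitVol w l W) {x : ℝ} (hx : x ∈ Icc (0 : ℝ) 1) :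
    Tendsto (fun n => ∫ y in (0 : ℝ)..x, w n y) l (𝓝 (∫ y in (0 : ℝ)..x, W y)) := by
  simp only [intervalIntegral_eq_unitVol le_rfl hx.1 hx.2]
  exact h _ (memLp_indicator_Ioo 0 x)

/-- A telescoping sum; the zero flux at the left boundary leaves no constant. -/
theorem intervalIntegral_fluxDiff {N : ℕ} (h2 : 2 ≤ N) (v : Fin (N + 1) → ℝ) (i : ℕ) :
    ∫ x in (0 : ℝ)..(i * spacing N), stepFn N (fluxDiff N v) x = nodalFlux N v i := by
  have hε := spacing_pos h2
  simp only [stepFn]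
  rw [intervalIntegral_floor _ hε, Finset.mul_sum]
  have : ∀ j ∈ Finset.range i, spacing N * fluxDiff N v j =
      nodalFlux N v (j + 1) - nodalFlux N v j := by
    intro j _
    unfold fluxDiff
    field_simp
  rw [Finset.sum_congr rfl this, Finset.sum_range_sub]
  simp [nodalFlux]

theorem integral_fluxDiff_sq_le {N : ℕ} (h2 : 2 ≤ N) (v : Fin (N + 1) → ℝ) :
    ∫ x, stepFn N (fluxDiff N v) x ^ 2 ∂unitVol ≤ dissipation N v := by
  rw [integral_stepFn_sq h2, dissipation, Finset.sum_range_succ]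
  have := spacing_pos h2
  have : 0 ≤ spacing N * fluxDiff N v N ^ 2 := by positivity
  linarith

/-- The flux drops to `0` beyond the last node, and the dissipation charges that drop through its
term of index `N`. This is the source of the condition at `x = 1`. -/
theorem nodalFlux_last_sq_le {N : ℕ} (h2 : 2 ≤ N) (v : Fin (N + 1) → ℝ) :
    nodalFlux N v N ^ 2 ≤ dissipation N v * spacing N := by
  have hε := spacing_pos h2
  have h1 : spacing N * fluxDiff N v N ^ 2 ≤ dissipation N v :=
    Finset.single_le_sum (f := fun i => spacing N * fluxDiff N v i ^ 2)
      (fun i _ => by positivity) (Finset.self_mem_range_succ N)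
  have h3 : fluxDiff N v N = - nodalFlux N v N / spacing N := by
    rw [fluxDiff, nodalFlux, bondFlux_of_ge v le_rfl, zero_sub]
  calc nodalFlux N v N ^ 2 = spacing N * fluxDiff N v N ^ 2 * spacing N := by
        rw [h3]; field_simp
    _ ≤ _ := by gcongr

/-! ### Convergence of the fluxes under bounded dissipation. -/

section GoodTimes

variable {N : ℕ → ℕ} {V : (n : ℕ) → Fin (N n + 1) → ℝ} {R : ℝ} {𝒰 : Ultrafilter ℕ} {W : ℝ → ℝ}

/-- Equi-Hölder continuity replaces the moving endpoint `i n * ε` by `x`; weak convergence handles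
the fixed endpoint. -/
theorem tendsto_nodalFlux (hN2 : ∀ n, 2 ≤ N n)
    (hR : ∀ᶠ n in 𝒰, dissipation (N n) (V n) ≤ R)
    (hW : WeakTendsto unitVol (fun n => stepFn (N n) (fluxDiff (N n) (V n))) 𝒰 W)
    {i : ℕ → ℕ} {x : ℝ} (hx : x ∈ Icc (0 : ℝ) 1) (hi : ∀ᶠ n in 𝒰, i n ≤ N n)
    (hix : Tendsto (fun n => i n * spacing (N n)) 𝒰 (𝓝 x)) :
    Tendsto (fun n => nodalFlux (N n) (V n) (i n)) 𝒰 (𝓝 (∫ y in (0 : ℝ)..x, W y)) := by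
  have h1 := hW.intervalIntegral hx
  have h2 : Tendsto (fun n => √(R * |i n * spacing (N n) - x|)) 𝒰 (𝓝 0) := by
    have := ((hix.sub_const x).abs.const_mul R).sqrt
    simpa using this
  have h3 : Tendsto (fun n => nodalFlux (N n) (V n) (i n) -
      ∫ y in (0 : ℝ)..x, stepFn (N n) (fluxDiff (N n) (V n)) y) 𝒰 (𝓝 0) := by
    refine squeeze_zero_norm' ?_ h2
    filter_upwards [hR, hi] with n hn hin
    rw [← intervalIntegral_fluxDiff (hN2 n) (V n) (i n)]
    have hε := spacing_pos (hN2 n)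
    refine abs_intervalIntegral_sub_le (memLp_stepFn (hN2 n) _ _)
      ((integral_fluxDiff_sq_le (hN2 n) _).trans hn) hx ⟨by positivity, ?_⟩
    rw [← natCast_mul_spacing (hN2 n)]
    exact mul_le_mul_of_nonneg_right (by exact_mod_cast hin) hε.le
  simpa using h3.add h1

theorem integral_limit_flux_eq_zero (hN2 : ∀ n, 2 ≤ N n) (hN : Tendsto N atTop atTop)
    (h𝒰 : (𝒰 : Filter ℕ) ≤ atTop) (hR : ∀ᶠ n in 𝒰, dissipation (N n) (V n) ≤ R)
    (hW : WeakTendsto unitVol (fun n => stepFn (N n) (fluxDiff (N n) (V n))) 𝒰 W) :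
    ∫ y in (0 : ℝ)..1, W y = 0 := by
  have h1 := tendsto_nodalFlux hN2 hR hW (i := N) (x := 1) ⟨zero_le_one, le_rfl⟩
    (Eventually.of_forall fun _ => le_rfl) (by simp [natCast_mul_spacing, hN2])
  have h2 : Tendsto (fun n => √(R * spacing (N n))) 𝒰 (𝓝 0) := by
    have := (((tendsto_spacing hN).mono_left h𝒰).const_mul R).sqrt
    simpa using this
  refine tendsto_nhds_unique h1 (squeeze_zero_norm' ?_ h2)
  filter_upwards [hR] with n hn
  have hε := spacing_pos (hN2 n)
  refine Real.abs_le_sqrt ((nodalFlux_last_sq_le (hN2 n) _).trans ?_)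
  gcongr

theorem eventually_abs_bondFlux_sub_le (hN2 : ∀ n, 2 ≤ N n) (hN : Tendsto N atTop atTop)
    (h𝒰 : (𝒰 : Filter ℕ) ≤ atTop) (hR : ∀ᶠ n in 𝒰, dissipation (N n) (V n) ≤ R)
    (hW : WeakTendsto unitVol (fun n => stepFn (N n) (fluxDiff (N n) (V n))) 𝒰 W)
    (hW2 : MemLp W 2 unitVol) {η : ℝ} (hη : 0 < η) :
    ∀ᶠ n in 𝒰, ∀ x ∈ Ico (0 : ℝ) 1,
      |stepFn (N n) (bondFlux (N n) (V n)) x - ∫ y in (0 : ℝ)..x, W y| ≤ η := by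
  by_contra hcon
  rw [← Ultrafilter.eventually_not] at hcon
  simp only [not_forall] at hcon
  -- A point of failure is picked whenever there is one, and `0` otherwise. Its limit `y` along `𝒰`
  -- contradicts convergence of the nodal fluxes at `y`.
  have hex : ∀ n, ∃ x ∈ Ico (0 : ℝ) 1, (¬ ∀ x ∈ Ico (0 : ℝ) 1,
      |stepFn (N n) (bondFlux (N n) (V n)) x - ∫ y in (0 : ℝ)..x, W y| ≤ η) →
      ¬ |stepFn (N n) (bondFlux (N n) (V n)) x - ∫ y in (0 : ℝ)..x, W y| ≤ η := by
    intro n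
    by_cases h : ∀ x ∈ Ico (0 : ℝ) 1,
      |stepFn (N n) (bondFlux (N n) (V n)) x - ∫ y in (0 : ℝ)..x, W y| ≤ η
    · exact ⟨0, ⟨le_rfl, one_pos⟩, fun h' => absurd h h'⟩
    · have h' := h
      push Not at h
      obtain ⟨x, hx, hx2⟩ := h
      exact ⟨x, hx, fun _ => not_le.2 hx2⟩
  choose x hx hbad using hex
  obtain ⟨y, hy, hlim⟩ := (isCompact_Icc (a := (0 : ℝ)) (b := 1)).ultrafilter_le_nhds' (𝒰.map x)
    (by rw [Ultrafilter.mem_map]; exact univ_mem' fun n => Ico_subset_Icc_self (hx n))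
  have hxy : Tendsto x 𝒰 (𝓝 y) := hlim
  have hε0 := (tendsto_spacing hN).mono_left h𝒰
  have hi : Tendsto (fun n => ((⌊x n / spacing (N n)⌋₊ + 1 : ℕ) : ℝ) * spacing (N n)) 𝒰
      (𝓝 y) := by
    refine tendsto_of_tendsto_of_tendsto_of_le_of_le hxy
      (by simpa using hxy.add hε0 : Tendsto (fun n => x n + spacing (N n)) 𝒰 (𝓝 y))
      (fun n => ?_) fun n => ?_
    · have := lt_floor_div_add_one_mul (x := x n) (spacing_pos (hN2 n))
      push_cast
      exact this.le
    · have := floor_div_mul_le (spacing_pos (hN2 n)) (hx n).1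
      push_cast
      linarith
  have h1 := tendsto_nodalFlux hN2 hR hW hy
    (Eventually.of_forall fun n => floor_lt_of_lt_one (hN2 n) (hx n).2) hi
  have h2 : Tendsto (fun n => ∫ z in (0 : ℝ)..x n, W z) 𝒰 (𝓝 (∫ z in (0 : ℝ)..y, W z)) := by
    rw [tendsto_iff_norm_sub_tendsto_zero]
    have h3 : Tendsto (fun n => √((∫ z, W z ^ 2 ∂unitVol) * |x n - y|)) 𝒰 (𝓝 0) := by
      have := ((hxy.sub_const y).abs.const_mul (∫ z, W z ^ 2 ∂unitVol)).sqrt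
      simpa using this
    refine squeeze_zero (fun _ => norm_nonneg _) (fun n => ?_) h3
    exact abs_intervalIntegral_sub_le hW2 le_rfl hy (Ico_subset_Icc_self (hx n))
  have h3 := (h1.sub h2).abs
  rw [sub_self, abs_zero] at h3
  obtain ⟨n, hn1, hn2⟩ := ((h3.eventually (gt_mem_nhds hη)).and hcon).exists
  refine hbad n ?_ hn1.le
  intro h
  obtain ⟨z, hz, hz2⟩ := hn2
  exact hz2 (h z hz)

theorem weakTendsto_bondFlux (hN2 : ∀ n, 2 ≤ N n) (hN : Tendsto N atTop atTop)
    (h𝒰 : (𝒰 : Filter ℕ) ≤ atTop) (hR : ∀ᶠ n in 𝒰, dissipation (N n) (V n) ≤ R)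
    (hW : WeakTendsto unitVol (fun n => stepFn (N n) (fluxDiff (N n) (V n))) 𝒰 W)
    (hW2 : MemLp W 2 unitVol) :
    MemLp (fun x => ∫ y in (0 : ℝ)..x, W y) 2 unitVol ∧
    WeakTendsto unitVol (fun n => stepFn (N n) (bondFlux (N n) (V n))) 𝒰
      (fun x => ∫ y in (0 : ℝ)..x, W y) := by
  have hcont : ContinuousOn (fun x => ∫ y in (0 : ℝ)..x, W y) (Icc 0 1) := by
    have := intervalIntegral.continuousOn_primitive_interval' (μ := volume)
      (intervalIntegrable_of_memLp hW2 ⟨le_rfl, zero_le_one⟩ ⟨zero_le_one, le_rfl⟩) left_mem_uIcc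
    rwa [uIcc_of_le zero_le_one] at this
  have hmem : MemLp (fun x => ∫ y in (0 : ℝ)..x, W y) 2 unitVol := by
    obtain ⟨B, hB⟩ := isCompact_Icc.exists_bound_of_continuousOn hcont
    refine MemLp.of_bound ((hcont.mono Ioo_subset_Icc_self).aestronglyMeasurable
      measurableSet_Ioo) B ?_
    filter_upwards [ae_restrict_mem measurableSet_Ioo] with x hx
    exact hB x (Ioo_subset_Icc_self hx)
  refine ⟨hmem, weakTendsto_of_tendsto_eLpNorm (fun n => memLp_stepFn (hN2 n) _ _) hmem ?_⟩
  rw [ENNReal.tendsto_nhds_zero]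
  intro η hη
  obtain ⟨r, hr0, hr⟩ : ∃ r : ℝ, 0 < r ∧ ENNReal.ofReal r ≤ η := by
    rcases eq_or_ne η ⊤ with rfl | h
    · exact ⟨1, one_pos, le_top⟩
    · exact ⟨η.toReal, ENNReal.toReal_pos hη.ne' h, by rw [ENNReal.ofReal_toReal h]⟩
  filter_upwards [eventually_abs_bondFlux_sub_le hN2 hN h𝒰 hR hW hW2 hr0] with n hn
  refine le_trans ?_ hr
  have := eLpNorm_le_of_ae_bound (p := 2) (μ := unitVol) (C := r)
    (f := fun x => stepFn (N n) (bondFlux (N n) (V n)) x - ∫ y in (0 : ℝ)..x, W y) (by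
      filter_upwards [ae_restrict_mem measurableSet_Ioo] with x hx
      exact hn x (Ioo_subset_Ico_self hx))
  simpa using this

end GoodTimes

/-! ### Vanishing of the limit flux at jump points. -/

section JumpPoints

/-- The Cauchy criterion for the filter `𝓝 x₀ ⊓ ae volume`. -/
theorem exists_essential_limit {f : ℝ → ℝ} {x₀ : ℝ} (hx₀ : x₀ ∈ Ioo (0 : ℝ) 1)
    (h : ∀ η > 0, ∃ δ > 0, ∃ E : Set ℝ, (∀ᵐ x ∂unitVol, x ∈ E) ∧
      ∀ x ∈ E ∩ Ioo 0 1, ∀ y ∈ E ∩ Ioo 0 1, |x - x₀| < δ → |y - x₀| < δ → |f x - f y| ≤ η) :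
    ∃ a, Tendsto f (𝓝 x₀ ⊓ ae volume) (𝓝 a) := by
  rcases eq_or_neBot (𝓝 x₀ ⊓ ae volume) with hbot | hne
  · exact ⟨0, by rw [hbot]; exact tendsto_bot⟩
  rw [← cauchy_map_iff_exists_tendsto, Metric.cauchy_iff]
  refine ⟨inferInstance, fun η hη => ?_⟩
  obtain ⟨δ, hδ, E, hE, hosc⟩ := h (η / 2) (half_pos hη)
  rw [ae_restrict_iff' measurableSet_Ioo] at hE
  refine ⟨f '' (E ∩ Ioo 0 1 ∩ Metric.ball x₀ δ), ?_, ?_⟩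
  · refine image_mem_map ?_
    have h1 : Ioo (0 : ℝ) 1 ∩ Metric.ball x₀ δ ∈ 𝓝 x₀ :=
      inter_mem (isOpen_Ioo.mem_nhds hx₀) (Metric.ball_mem_nhds _ hδ)
    filter_upwards [mem_inf_of_left h1, mem_inf_of_right hE] with x hx1 hx2
    exact ⟨⟨hx2 hx1.1, hx1.1⟩, hx1.2⟩
  · rintro _ ⟨x, ⟨hx1, hx2⟩, rfl⟩ _ ⟨y, ⟨hy1, hy2⟩, rfl⟩
    rw [Real.dist_eq]
    have := hosc x hx1 y hy1 hx2 hy2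
    linarith

/-- Near a jump point of the limit, the lattice functions have increments bounded from below. -/
theorem exists_large_incr_of_mem_jumpSet {N : ℕ → ℕ} (hN2 : ∀ n, 2 ≤ N n)
    (hN : Tendsto N atTop atTop)
    {V : (n : ℕ) → Fin (N n + 1) → ℝ} {M : ℝ} (hM : ∀ n, energy (N n) (V n) ≤ M)
    {f : ℝ → ℝ} (hf2 : AEStronglyMeasurable f unitVol)
    (hf : Tendsto (fun n => eLpNorm (fun x => interp (N n) (V n) x - f x) 2 unitVol) atTop (𝓝 0))
    {𝒰 : Ultrafilter ℕ} (h𝒰 : (𝒰 : Filter ℕ) ≤ atTop) {x₀ : ℝ} (hx₀ : x₀ ∈ jumpSet f) :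
    ∃ c > 0, ∀ δ > 0, ∀ᶠ n in 𝒰, ∃ i < N n, |i * spacing (N n) - x₀| < δ ∧
      c ≤ |incr (N n) (V n) i| := by
  by_contra hcon
  push Not at hcon
  have hM0 : 0 ≤ M := (energy_nonneg _).trans (hM 0)
  refine hx₀.2 (exists_essential_limit hx₀.1 fun η hη => ?_)
  -- Each of the three terms of `abs_nodal_sub_le` is to be at most `η/3`; this `c` serves the term
  -- `2 * M * c`.
  set c := η / (6 * M + 1) with hc
  have hc0 : 0 < c := by positivity
  have hcM : 2 * M * c ≤ η / 3 := by
    rw [hc]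
    have : 2 * M * (η / (6 * M + 1)) = η / 3 * (6 * M / (6 * M + 1)) := by ring
    rw [this]
    refine mul_le_of_le_one_right (by positivity) ?_
    rw [div_le_one (by positivity)]; linarith
  obtain ⟨δ, hδ, hnot⟩ := hcon c hc0
  have hsmall : ∀ᶠ n in 𝒰, ∀ i < N n, |i * spacing (N n) - x₀| < δ →
      |incr (N n) (V n) i| < c := hnot
  -- Rounding down to cell ends moves points by less than `ε < δ'`: the bonds used stay within `2δ'`
  -- of `x₀`, and their range has length below `3δ'`.
  obtain ⟨δ', hδ', hδδ', hMδ'⟩ : ∃ δ' > 0, 2 * δ' ≤ δ ∧ √(M * (3 * δ')) ≤ η / 3 := by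
    refine ⟨min (δ / 2) ((η / 3) ^ 2 / (3 * (M + 1))), by positivity, ?_, ?_⟩
    · linarith [min_le_left (δ / 2) ((η / 3) ^ 2 / (3 * (M + 1)))]
    · rw [Real.sqrt_le_left (by positivity)]
      calc M * (3 * min (δ / 2) ((η / 3) ^ 2 / (3 * (M + 1))))
          ≤ (M + 1) * (3 * ((η / 3) ^ 2 / (3 * (M + 1)))) := by
            gcongr
            · linarith
            · exact min_le_right _ _
        _ = (η / 3) ^ 2 := by field_simp
  have hmid : ∀ᶠ n in atTop, √√(spacing (N n)) * (logSpacing (N n) * M) < η / 3 := by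
    have := (tendsto_sqrt_sqrt_spacing_mul_logSpacing hN).mul_const M
    rw [zero_mul] at this
    filter_upwards [this.eventually (gt_mem_nhds (by positivity : 0 < η / 3))] with n hn
    rwa [← mul_assoc]
  have hosc : ∀ᶠ n in 𝒰, ∀ x ∈ Ioo (0 : ℝ) 1, ∀ y ∈ Ioo (0 : ℝ) 1, |x - x₀| < δ' →
      |y - x₀| < δ' → |interp (N n) (V n) x - interp (N n) (V n) y| ≤ η := by
    filter_upwards [hsmall, h𝒰 hmid, h𝒰 (hN.eventually_ge_atTop 3),
      h𝒰 ((tendsto_spacing hN).eventually (gt_mem_nhds hδ'))] with n h1 h2 h3 h4 x hx y hy hx' hy'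
    wlog hxy : x ≤ y generalizing x y
    · rw [abs_sub_comm]
      exact this y hy x hx hy' hx' (le_of_not_ge hxy)
    have hε := spacing_pos (hN2 n)
    rw [abs_lt] at hx' hy'
    have ax := floor_div_mul_le hε hx.1.le
    have ax' := lt_floor_div_add_one_mul (x := x) hε
    have ay := floor_div_mul_le hε hy.1.le
    have hij : ⌊x / spacing (N n)⌋₊ ≤ ⌊y / spacing (N n)⌋₊ := by gcongr
    have hj := floor_lt_of_lt_one (hN2 n) hy.2
    have key := abs_nodal_sub_le h3 (hM n) hc0.le hij hj.le (fun l hl => by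
      rw [Finset.mem_Ico] at hl
      refine (h1 l (by omega) ?_).le
      have l1 : (⌊x / spacing (N n)⌋₊ : ℝ) * spacing (N n) ≤ l * spacing (N n) :=
        mul_le_mul_of_nonneg_right (by exact_mod_cast hl.1) hε.le
      have l2 : (l : ℝ) * spacing (N n) ≤ ⌊y / spacing (N n)⌋₊ * spacing (N n) :=
        mul_le_mul_of_nonneg_right (by exact_mod_cast hl.2.le) hε.le
      rw [abs_lt]
      constructor <;> nlinarith)
    rw [abs_sub_comm]
    refine key.trans ?_
    have : √(M * (((⌊y / spacing (N n)⌋₊ : ℝ) - ⌊x / spacing (N n)⌋₊) * spacing (N n))) ≤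
        √(M * (3 * δ')) := by
      apply Real.sqrt_le_sqrt
      refine mul_le_mul_of_nonneg_left ?_ hM0
      nlinarith
    linarith
  -- The filter `atTop ⊓ 𝓟 A` is countably generated, so an a.e. convergent subsequence with indices
  -- eventually in `A` can be extracted and the oscillation bound passes to `f`.
  set A : Set ℕ := {n | ∀ x ∈ Ioo (0 : ℝ) 1, ∀ y ∈ Ioo (0 : ℝ) 1, |x - x₀| < δ' →
      |y - x₀| < δ' → |interp (N n) (V n) x - interp (N n) (V n) y| ≤ η} with hA
  have hne : NeBot (atTop ⊓ 𝓟 A) :=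
    neBot_of_le (f := (𝒰 : Filter ℕ)) (le_inf h𝒰 (le_principal_iff.2 hosc))
  have hmeas : TendstoInMeasure unitVol (fun n => interp (N n) (V n)) (atTop ⊓ 𝓟 A) f :=
    tendstoInMeasure_of_tendsto_eLpNorm two_ne_zero
      (fun n => (memLp_interp (hN2 n) (V n) 2).1) hf2 (hf.mono_left inf_le_left)
  obtain ⟨ns, hns, hae⟩ := hmeas.exists_seq_tendsto_ae'
  refine ⟨δ', hδ', {x | Tendsto (fun k => interp (N (ns k)) (V (ns k)) x) atTop (𝓝 (f x))}, hae,
    fun x hx y hy hx' hy' => ?_⟩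
  refine le_of_tendsto ((Tendsto.sub hx.1 hy.1).abs) ?_
  filter_upwards [hns.eventually (mem_inf_of_right (mem_principal_self A))] with k hk
  exact hk x hx.2 y hy.2 hx' hy'

/-- The fluxes of the large increments near `x₀` tend both to `0`, by `abs_flux_le`, and to `∫₀^{x₀}
W`, by `tendsto_nodalFlux`. -/
theorem limit_flux_eq_zero_of_mem_jumpSet {N : ℕ → ℕ} (hN2 : ∀ n, 2 ≤ N n)
    (hN : Tendsto N atTop atTop)
    {V : (n : ℕ) → Fin (N n + 1) → ℝ} {M : ℝ} (hM : ∀ n, energy (N n) (V n) ≤ M)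
    {f : ℝ → ℝ} (hf2 : AEStronglyMeasurable f unitVol)
    (hf : Tendsto (fun n => eLpNorm (fun x => interp (N n) (V n) x - f x) 2 unitVol) atTop (𝓝 0))
    {𝒰 : Ultrafilter ℕ} (h𝒰 : (𝒰 : Filter ℕ) ≤ atTop) {R : ℝ}
    (hR : ∀ᶠ n in 𝒰, dissipation (N n) (V n) ≤ R) {W : ℝ → ℝ}
    (hW : WeakTendsto unitVol (fun n => stepFn (N n) (fluxDiff (N n) (V n))) 𝒰 W)
    {x₀ : ℝ} (hx₀ : x₀ ∈ jumpSet f) :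
    ∫ y in (0 : ℝ)..x₀, W y = 0 := by
  obtain ⟨c, hc, hbond⟩ := exists_large_incr_of_mem_jumpSet hN2 hN hM hf2 hf h𝒰 hx₀
  -- Taking the bond nearest to `x₀` among those with increment at least `c` gives one sequence that
  -- works for every `δ`.
  have hex : ∀ n, ∃ i < N n, ∀ j < N n, c ≤ |incr (N n) (V n) j| →
      c ≤ |incr (N n) (V n) i| ∧ |i * spacing (N n) - x₀| ≤ |j * spacing (N n) - x₀| := by
    intro n
    by_cases h : ((Finset.range (N n)).filter fun j => c ≤ |incr (N n) (V n) j|).Nonempty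
    · obtain ⟨i, hi, hmin⟩ := Finset.exists_min_image _ (fun j : ℕ => |j * spacing (N n) - x₀|) h
      simp only [Finset.mem_filter, Finset.mem_range] at hi hmin
      exact ⟨i, hi.1, fun j hj hcj => ⟨hi.2, hmin j ⟨hj, hcj⟩⟩⟩
    · refine ⟨0, by have := hN2 n; omega, fun j hj hcj => absurd ⟨j, ?_⟩ h⟩
      simp [hj, hcj]
  choose i hi hmin using hex
  have hε0 := (tendsto_spacing hN).mono_left h𝒰
  have hix : Tendsto (fun n => (i n : ℝ) * spacing (N n)) 𝒰 (𝓝 x₀) := by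
    rw [Metric.tendsto_nhds]
    intro δ hδ
    filter_upwards [hbond δ hδ] with n hn
    obtain ⟨j, hj, hj1, hj2⟩ := hn
    rw [Real.dist_eq]
    exact (hmin n j hj hj2).2.trans_lt hj1
  have hlim := tendsto_nodalFlux hN2 hR hW (i := fun n => i n + 1) (Ioo_subset_Icc_self hx₀.1)
    (Eventually.of_forall fun n => hi n)
    (by simpa [add_mul] using hix.add hε0)
  have hzero : Tendsto (fun n => 2 / (logSpacing (N n) * c)) 𝒰 (𝓝 0) :=
    (((tendsto_logSpacing hN).atTop_mul_const hc).const_div_atTop 2).mono_left h𝒰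
  refine tendsto_nhds_unique hlim (squeeze_zero_norm' ?_ hzero)
  filter_upwards [hbond 1 one_pos] with n hn
  obtain ⟨j, hj, -, hj2⟩ := hn
  exact abs_flux_le (hN2 n) hc (hmin n j hj hj2).1

end JumpPoints

/-! ### The Euler–Lagrange equation of one minimization step. -/

theorem hasDerivAt_bondEnergy {N : ℕ} (h2 : 2 ≤ N) (d : ℝ) :
    HasDerivAt (fun d => 1 / logSpacing N * Real.log (1 + excess N d)) (flux N d) d := by
  have hε := spacing_pos h2
  have hL := logSpacing_pos h2
  have hs := excess_nonneg N d
  have h1 : HasDerivAt (fun d => 1 + excess N d)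
      (logSpacing N * (2 * d / spacing N)) d := by
    unfold excess
    have := (((hasDerivAt_pow 2 d).div_const (spacing N)).const_mul (logSpacing N)).const_add 1
    simpa using this
  have h3 := (h1.log (by linarith)).const_mul (1 / logSpacing N)
  refine h3.congr_deriv ?_
  unfold flux
  field_simp

theorem stepFunctional_eq {N : ℕ} (τ : ℝ) (w v h : Fin (N + 1) → ℝ) (s : ℝ) :
    stepFunctional N τ w (fun i => v i + s * h i) =
      ∑ i ∈ Finset.range N, 1 / logSpacing N *
        Real.log (1 + excess N (incr N v i + s * incr N h i)) +
      1 / (2 * τ) * ∑ i ∈ Finset.range (N + 1),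
        spacing N * (nodal N v i + s * nodal N h i - nodal N w i) ^ 2 := by
  unfold stepFunctional
  congr 1
  · rw [energy_eq_sum]
    refine Finset.sum_congr rfl fun i _ => ?_
    congr 4
    simp only [incr, nodal]
    ring
  · congr 1
    simp only [sq_abs]
    exact sum_nodes_eq (fun i => v i + s * h i) w (fun a b => spacing N * (a - b) ^ 2)

theorem euler_lagrange_weak {N : ℕ} (h2 : 2 ≤ N) {τ : ℝ} {w v : Fin (N + 1) → ℝ}
    (hmin : ∀ v', stepFunctional N τ w v ≤ stepFunctional N τ w v') (h : Fin (N + 1) → ℝ) :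
    ∑ i ∈ Finset.range N, bondFlux N v i * incr N h i +
      1 / τ * ∑ i ∈ Finset.range (N + 1),
        spacing N * (nodal N v i - nodal N w i) * nodal N h i = 0 := by
  have hd1 : ∀ a b : ℝ, HasDerivAt (fun s : ℝ => a + s * b) b 0 := fun a b => by
    simpa using ((hasDerivAt_id' (0 : ℝ)).mul_const b).const_add a
  have hd : HasDerivAt (fun s => stepFunctional N τ w (fun i => v i + s * h i))
      (∑ i ∈ Finset.range N, bondFlux N v i * incr N h i + 1 / (2 * τ) *
        ∑ i ∈ Finset.range (N + 1),
          spacing N * (2 * (nodal N v i - nodal N w i) * nodal N h i)) 0 := by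
    simp only [stepFunctional_eq]
    refine HasDerivAt.add ?_ (HasDerivAt.const_mul _ ?_)
    · refine HasDerivAt.fun_sum fun i _ => ?_
      have := (hasDerivAt_bondEnergy h2 (incr N v i)).comp_of_eq (0 : ℝ)
        (hd1 (incr N v i) (incr N h i)) (by simp)
      exact this
    · refine HasDerivAt.fun_sum fun i _ => ?_
      have := (((hd1 (nodal N v i) (nodal N h i)).sub_const (nodal N w i)).pow 2).const_mul
        (spacing N)
      simpa using this
  have h0 : IsLocalMin (fun s => stepFunctional N τ w (fun i => v i + s * h i)) 0 :=
    Eventually.of_forall fun s => by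
      simpa using hmin (fun i => v i + s * h i)
  rw [← h0.hasDerivAt_eq_zero hd]
  congr 1
  rw [Finset.mul_sum, Finset.mul_sum]
  refine Finset.sum_congr rfl fun i _ => ?_
  by_cases hτ : τ = 0
  · simp [hτ]
  · field_simp

/-- The variation is the indicator of the first `j` nodes: only one bond sees it, with increment
`-1`. When it covers all nodes no bond does, in accordance with zero flux at the right end. -/
theorem nodalFlux_eq_sum {N : ℕ} (h2 : 2 ≤ N) {τ : ℝ} {w v : Fin (N + 1) → ℝ}
    (hmin : ∀ v', stepFunctional N τ w v ≤ stepFunctional N τ w v') {j : ℕ} (hj : j ≤ N + 1) :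
    nodalFlux N v j = 1 / τ * ∑ i ∈ Finset.range j, spacing N * (nodal N v i - nodal N w i) := by
  cases j with
  | zero => simp [nodalFlux]
  | succ j =>
    have hj' : j ≤ N := by omega
    have key := euler_lagrange_weak h2 hmin (fun i => if (i : ℕ) ≤ j then 1 else 0)
    have hn : ∀ i ≤ N, nodal N (fun i => if (i : ℕ) ≤ j then (1 : ℝ) else 0) i =
        if i ≤ j then 1 else 0 := fun i hi => by rw [nodal_of_le _ hi]
    have e1 : ∑ i ∈ Finset.range N, bondFlux N v i *
        incr N (fun i => if (i : ℕ) ≤ j then (1 : ℝ) else 0) i = - bondFlux N v j := by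
      have : ∀ i ∈ Finset.range N, bondFlux N v i *
          incr N (fun i => if (i : ℕ) ≤ j then (1 : ℝ) else 0) i =
          if j = i then - bondFlux N v j else 0 := by
        intro i hi
        rw [Finset.mem_range] at hi
        rw [incr, hn i hi.le, hn (i + 1) hi]
        rcases lt_trichotomy i j with h | h | h
        · rw [if_pos (by omega), if_pos (by omega), if_neg (by omega)]; ring
        · rw [if_neg (by omega), if_pos (by omega), if_pos h.symm, h]; ring
        · rw [if_neg (by omega), if_neg (by omega), if_neg (by omega)]; ring
      rw [Finset.sum_congr rfl this, Finset.sum_ite_eq]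
      by_cases h : j ∈ Finset.range N
      · rw [if_pos h]
      · rw [if_neg h, bondFlux_of_ge v (by simpa using h), neg_zero]
    have e2 : ∑ i ∈ Finset.range (N + 1), spacing N * (nodal N v i - nodal N w i) *
        nodal N (fun i => if (i : ℕ) ≤ j then (1 : ℝ) else 0) i =
        ∑ i ∈ Finset.range (j + 1), spacing N * (nodal N v i - nodal N w i) := by
      rw [← Finset.sum_subset (Finset.range_mono hj)]
      · refine Finset.sum_congr rfl fun i hi => ?_
        rw [Finset.mem_range] at hi
        rw [hn i (by omega), if_pos (by omega), mul_one]
      · intro i hi hi'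
        rw [Finset.mem_range] at hi hi'
        rw [hn i (by omega), if_neg (by omega), mul_zero]
    rw [e1, e2] at key
    simp only [nodalFlux]
    linarith

theorem euler_lagrange {N : ℕ} (h2 : 2 ≤ N) {τ : ℝ} {w v : Fin (N + 1) → ℝ}
    (hmin : ∀ v', stepFunctional N τ w v ≤ stepFunctional N τ w v') {i : ℕ} (hi : i ≤ N) :
    nodal N v i - nodal N w i = τ * fluxDiff N v i ∨ τ = 0 := by
  by_cases hτ : τ = 0
  · exact Or.inr hτ
  left
  have hε := spacing_pos h2
  rw [fluxDiff, nodalFlux_eq_sum h2 hmin (by omega : i + 1 ≤ N + 1),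
    nodalFlux_eq_sum h2 hmin (by omega : i ≤ N + 1), Finset.sum_range_succ]
  field_simp
  ring

theorem flux_nonneg {N : ℕ} {d : ℝ} (hd : 0 ≤ d) : 0 ≤ flux N d := by
  have := excess_nonneg N d
  unfold flux spacing
  positivity

theorem flux_neg (N : ℕ) (d : ℝ) : flux N (-d) = - flux N d := by
  simp only [flux, excess, neg_sq]
  ring

theorem flux_nonpos {N : ℕ} {d : ℝ} (hd : d ≤ 0) : flux N d ≤ 0 := by
  have := flux_nonneg (N := N) (neg_nonneg.2 hd)
  rw [flux_neg] at this
  linarith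

/-! ### Maximum principle and dissipation estimate for discrete movements. -/

section Movement

variable {N : ℕ} {τ : ℝ} {u₀ : Fin (N + 1) → ℝ} {U : ℕ → Fin (N + 1) → ℝ}

theorem IsDiscreteMovement.nodal_sub (hU : IsDiscreteMovement N τ u₀ U) (h2 : 2 ≤ N)
    (hτ : 0 < τ) (k : ℕ) {i : ℕ} (hi : i ≤ N) :
    nodal N (U (k + 1)) i - nodal N (U k) i = τ * fluxDiff N (U (k + 1)) i :=
  (euler_lagrange h2 (hU.2 k) hi).resolve_right hτ.ne'

/-- The maximum principle. -/
theorem IsDiscreteMovement.abs_le (hU : IsDiscreteMovement N τ u₀ U) (h2 : 2 ≤ N)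
    (hτ : 0 < τ) {C : ℝ} (hC : ∀ i, |u₀ i| ≤ C) (k : ℕ) (i : Fin (N + 1)) : |U k i| ≤ C := by
  have hε := spacing_pos h2
  induction k generalizing i with
  | zero => rw [hU.1]; exact hC i
  | succ k ih =>
    rw [_root_.abs_le]
    constructor
    -- At a minimal node the flux is nonpositive on the left and nonnegative on the right, also at
    -- the ends where it is zero. The value there has not decreased in this step.
    · obtain ⟨j, hj⟩ := Finite.exists_min (U (k + 1))
      refine le_trans ?_ (hj i)
      have hjN : (j : ℕ) ≤ N := Nat.le_of_lt_succ j.2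
      have h := hU.nodal_sub h2 hτ k hjN
      rw [nodal_of_le _ hjN, nodal_of_le _ hjN] at h
      have h3 : 0 ≤ fluxDiff N (U (k + 1)) j := by
        refine div_nonneg (sub_nonneg.2 (le_trans (b := 0) ?_ ?_)) hε.le
        · rcases hj0 : (j : ℕ) with _ | m
          · exact le_rfl
          · refine flux_nonpos (sub_nonpos.2 ?_)
            rw [← hj0, nodal_of_le _ hjN]
            exact hj _
        · refine flux_nonneg (sub_nonneg.2 ?_)
          rw [nodal_of_le _ hjN]
          exact hj _
      have h4 := (_root_.abs_le.1 (ih j)).1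
      have h5 := mul_nonneg hτ.le h3
      simp only [Fin.eta] at h
      linarith
    · obtain ⟨j, hj⟩ := Finite.exists_max (U (k + 1))
      refine le_trans (hj i) ?_
      have hjN : (j : ℕ) ≤ N := Nat.le_of_lt_succ j.2
      have h := hU.nodal_sub h2 hτ k hjN
      rw [nodal_of_le _ hjN, nodal_of_le _ hjN] at h
      have h3 : fluxDiff N (U (k + 1)) j ≤ 0 := by
        refine div_nonpos_of_nonpos_of_nonneg (sub_nonpos.2 (le_trans (b := 0) ?_ ?_)) hε.le
        · refine flux_nonpos (sub_nonpos.2 ?_)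
          rw [nodal_of_le _ hjN]
          exact hj _
        · rcases hj0 : (j : ℕ) with _ | m
          · exact le_rfl
          · refine flux_nonneg (sub_nonneg.2 ?_)
            rw [← hj0, nodal_of_le _ hjN]
            exact hj _
      have h4 := (_root_.abs_le.1 (ih j)).2
      have h5 := mul_nonpos_of_nonneg_of_nonpos hτ.le h3
      simp only [Fin.eta] at h
      linarith

theorem dissipation_nonneg (N : ℕ) (v : Fin (N + 1) → ℝ) : 0 ≤ dissipation N v := by
  unfold dissipation spacing
  exact Finset.sum_nonneg fun i _ => by positivity

/-- The previous state is the competitor; the Euler–Lagrange equation turns the distance penalty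
into `τ/2` times the dissipation. -/
theorem IsDiscreteMovement.energy_add_dissipation_le (hU : IsDiscreteMovement N τ u₀ U)
    (h2 : 2 ≤ N) (hτ : 0 < τ) (k : ℕ) :
    energy N (U (k + 1)) + τ / 2 * dissipation N (U (k + 1)) ≤ energy N (U k) := by
  have h := hU.2 k (U k)
  unfold stepFunctional at h
  simp only [sub_self, abs_zero, sq_abs] at h
  have e := sum_nodes_eq (U (k + 1)) (U k) (fun a b => spacing N * (a - b) ^ 2)
  have e2 : ∑ i ∈ Finset.range (N + 1),
      spacing N * (nodal N (U (k + 1)) i - nodal N (U k) i) ^ 2 =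
      τ ^ 2 * dissipation N (U (k + 1)) := by
    rw [dissipation, Finset.mul_sum]
    refine Finset.sum_congr rfl fun i hi => ?_
    rw [hU.nodal_sub h2 hτ k (by rw [Finset.mem_range] at hi; omega)]
    ring
  rw [e, e2] at h
  have e3 : 1 / (2 * τ) * (τ ^ 2 * dissipation N (U (k + 1))) =
      τ / 2 * dissipation N (U (k + 1)) := by field_simp
  rw [e3] at h
  simpa using h

theorem IsDiscreteMovement.energy_add_sum_le (hU : IsDiscreteMovement N τ u₀ U) (h2 : 2 ≤ N)
    (hτ : 0 < τ) (k : ℕ) :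
    energy N (U k) + τ / 2 * ∑ j ∈ Finset.range k, dissipation N (U (j + 1)) ≤ energy N u₀ := by
  induction k with
  | zero => simp [hU.1]
  | succ k ih =>
    have := hU.energy_add_dissipation_le h2 hτ k
    rw [Finset.sum_range_succ]
    linarith

theorem IsDiscreteMovement.energy_le (hU : IsDiscreteMovement N τ u₀ U) (h2 : 2 ≤ N)
    (hτ : 0 < τ) {M : ℝ} (hM : energy N u₀ ≤ M) (k : ℕ) : energy N (U k) ≤ M := by
  have h1 := hU.energy_add_sum_le h2 hτ k
  have h3 : 0 ≤ ∑ j ∈ Finset.range k, dissipation N (U (j + 1)) :=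
    Finset.sum_nonneg fun j _ => dissipation_nonneg _ _
  have := mul_nonneg (half_pos hτ).le h3
  linarith

/-- The dissipation of a discrete movement at time `t`, set to zero in the first time step. -/
def dissipationAt (N : ℕ) (τ : ℝ) (U : ℕ → Fin (N + 1) → ℝ) (t : ℝ) : ℝ :=
  if ⌊t / τ⌋₊ = 0 then 0 else dissipation N (U ⌊t / τ⌋₊)

theorem measurable_dissipationAt (N : ℕ) (τ : ℝ) (U : ℕ → Fin (N + 1) → ℝ) :
    Measurable (dissipationAt N τ U) :=
  measurable_floor_div (fun k => if k = 0 then 0 else dissipation N (U k)) τ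

theorem dissipationAt_nonneg (N : ℕ) (τ : ℝ) (U : ℕ → Fin (N + 1) → ℝ) (t : ℝ) :
    0 ≤ dissipationAt N τ U t := by
  unfold dissipationAt
  split_ifs
  · exact le_rfl
  · exact dissipation_nonneg _ _

theorem one_le_floor_div {τ t : ℝ} (hτ : 0 < τ) (h : τ ≤ t) : 1 ≤ ⌊t / τ⌋₊ := by
  rw [Nat.one_le_floor_iff, le_div_iff₀ hτ, one_mul]
  exact h

theorem dissipationAt_of_le (hτ : 0 < τ) {t : ℝ} (h : τ ≤ t) :
    dissipationAt N τ U t = dissipation N (U ⌊t / τ⌋₊) := by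
  have := one_le_floor_div hτ h
  rw [dissipationAt, if_neg (by omega)]

theorem IsDiscreteMovement.lintegral_dissipationAt_le (hU : IsDiscreteMovement N τ u₀ U)
    (h2 : 2 ≤ N) (hτ : 0 < τ) {M : ℝ} (hM : energy N u₀ ≤ M) (T : ℝ) :
    ∫⁻ t in Ioo 0 T, ENNReal.ofReal (dissipationAt N τ U t) ≤ ENNReal.ofReal (2 * M) := by
  -- The first `m + 1` time cells cover `(0,T)`. The first contributes nothing, which matters since
  -- the initial datum is not assumed to satisfy an Euler–Lagrange equation.
  obtain ⟨m, hm⟩ := exists_nat_ge (T / τ)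
  rw [div_le_iff₀ hτ] at hm
  set a : ℕ → ℝ := fun k => if k = 0 then 0 else dissipation N (U k) with ha
  have hsum : ∑ k ∈ Finset.range (m + 1), a k = ∑ j ∈ Finset.range m, dissipation N (U (j + 1)) := by
    rw [Finset.sum_range_succ']
    simp [ha]
  have hint := intervalIntegral_floor a hτ (m + 1)
  have hii := intervalIntegrable_floor a hτ (m + 1)
  have h0 : (0 : ℝ) ≤ (m + 1 : ℕ) * τ := by positivity
  rw [intervalIntegral.integral_of_le h0] at hint
  rw [intervalIntegrable_iff_integrableOn_Ioc_of_le h0] at hii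
  calc ∫⁻ t in Ioo 0 T, ENNReal.ofReal (dissipationAt N τ U t)
      ≤ ∫⁻ t in Ioc 0 ((m + 1 : ℕ) * τ), ENNReal.ofReal (dissipationAt N τ U t) := by
        refine lintegral_mono_set fun t ht => ⟨ht.1, ?_⟩
        push_cast
        linarith [ht.2]
    _ = ENNReal.ofReal (∫ t in Ioc 0 ((m + 1 : ℕ) * τ), dissipationAt N τ U t) :=
        (ofReal_integral_eq_lintegral_ofReal hii
          (Eventually.of_forall (dissipationAt_nonneg N τ U))).symm
    _ ≤ ENNReal.ofReal (2 * M) := by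
        refine ENNReal.ofReal_le_ofReal ?_
        refine hint.trans_le ?_
        rw [hsum]
        have h1 := hU.energy_add_sum_le h2 hτ m
        have h3 := energy_nonneg (U m)
        linarith

end Movement

/-! ### Flux difference quotients against test functions. -/

section FluxDifference

theorem exists_abs_nodalFlux_le (N : ℕ) (v : Fin (N + 1) → ℝ) :
    ∃ B, ∀ i, |nodalFlux N v i| ≤ B := by
  refine ⟨∑ j ∈ Finset.range (N + 1), |nodalFlux N v j|, fun i => ?_⟩
  by_cases hi : i < N + 1
  · exact Finset.single_le_sum (f := fun j => |nodalFlux N v j|) (fun _ _ => abs_nonneg _)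
      (Finset.mem_range.2 hi)
  · obtain ⟨m, rfl⟩ : ∃ m, i = m + 1 := ⟨i - 1, by omega⟩
    rw [nodalFlux, bondFlux_of_ge v (by omega), abs_zero]
    exact Finset.sum_nonneg fun _ _ => abs_nonneg _

theorem integral_fluxDiff_mul {N : ℕ} (h2 : 2 ≤ N) (v : Fin (N + 1) → ℝ) {φ : ℝ → ℝ}
    (hφ : Integrable φ) (hs : ∀ x, φ x ≠ 0 → spacing N < x ∧ x < 1) :
    ∫ x, stepFn N (fluxDiff N v) x * φ x ∂unitVol =
      ∫ x, stepFn N (bondFlux N v) x * ((φ x - φ (x + spacing N)) / spacing N) ∂unitVol := by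
  have hε := spacing_pos h2
  have hz : ∀ x ∉ Ioo (0 : ℝ) 1, φ x = 0 := by
    intro x hx
    by_contra h
    exact hx ⟨hε.trans (hs x h).1, (hs x h).2⟩
  obtain ⟨B, hB⟩ := exists_abs_nodalFlux_le N v
  have h := integral_stepFn_diff_mul' h2 hB hφ (fun x hx => by
    by_contra h
    linarith [(hs x h).1])
  have h3 := congrArg (fun y => y / spacing N) h
  simp only [← integral_div] at h3
  rw [integral_unitVol_eq, integral_unitVol_eq]
  · refine Eq.trans ?_ (h3.trans ?_)
    · refine integral_congr_ae (Eventually.of_forall fun x => ?_)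
      simp only [stepFn, fluxDiff]; ring
    · exact integral_congr_ae (Eventually.of_forall fun x => mul_div_assoc _ _ _)
  · intro x hx
    have : φ (x + spacing N) = 0 := by
      by_contra h
      obtain ⟨h3, h4⟩ := hs _ h
      exact hx ⟨by linarith, by linarith⟩
    rw [hz x hx, this]; simp
  · intro x hx; rw [hz x hx, mul_zero]

theorem hasCompactSupport_diffQuot {φ : ℝ → ℝ} (hc : HasCompactSupport φ) (h c : ℝ) :
    HasCompactSupport fun x => (φ x - φ (x + h)) / c := by
  have h1 : HasCompactSupport fun x => φ (x + h) := by
    simpa [Function.comp_def] using hc.comp_homeomorph (Homeomorph.addRight h)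
  have := (hc.sub h1).mul_right (f' := fun _ => c⁻¹)
  simp only [div_eq_mul_inv]
  exact this

/-- With the difference on `φ`, the energy bound alone suffices, so this is available at every time
and not only where the dissipation is bounded. -/
theorem tendsto_integral_fluxDiff_mul {N : ℕ → ℕ} (hN2 : ∀ n, 2 ≤ N n)
    (hN : Tendsto N atTop atTop)
    {V : (n : ℕ) → Fin (N n + 1) → ℝ} {M : ℝ} (hM : ∀ n, energy (N n) (V n) ≤ M)
    {l : Filter ℕ} (hl : l ≤ atTop) {Z : ℝ → ℝ}
    (hZ : WeakTendsto unitVol (fun n => stepFn (N n) (bondFlux (N n) (V n))) l Z)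
    {φ : ℝ → ℝ} (hφ : ContDiff ℝ ∞ φ) (hc : HasCompactSupport φ) (hs : tsupport φ ⊆ Ioo 0 1) :
    Tendsto (fun n => ∫ x, stepFn (N n) (fluxDiff (N n) (V n)) x * φ x ∂unitVol) l
      (𝓝 (- ∫ x, Z x * deriv φ x ∂unitVol)) := by
  obtain ⟨δ, hδ, hm⟩ := exists_margin hc hs
  obtain ⟨K, hK0, hK⟩ := exists_lipschitz_deriv hφ hc
  have hε0 := (tendsto_spacing hN).mono_left hl
  have hφ' : Continuous (deriv φ) := hφ.continuous_deriv (by simp)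
  have h1 : Tendsto (fun n => ∫ x, stepFn (N n) (bondFlux (N n) (V n)) x *
      ((φ x - φ (x + spacing (N n))) / spacing (N n)) ∂unitVol) l
      (𝓝 (∫ x, Z x * (-deriv φ x) ∂unitVol)) := by
    refine hZ.integral_mul_of_uniform (fun n => memLp_stepFn (hN2 n) _ _) (B := 4 * M)
      (Eventually.of_forall fun n => integral_stepFn_bondFlux_sq_le (hN2 n) (hM n)) (fun n => ?_) ?_
      (r := fun n => K * spacing (N n)) (by simpa using hε0.const_mul K)
      (Eventually.of_forall fun n x => ?_)
    · exact memLp_unitVol_of_continuous ((hφ.continuous.sub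
        (hφ.continuous.comp (continuous_id.add continuous_const))).div_const _)
        (hasCompactSupport_diffQuot hc _ _)
    · exact (memLp_unitVol_of_continuous hφ' hc.deriv).neg
    · have hε := spacing_pos (hN2 n)
      have := abs_sub_sub_mul_deriv_le (hφ.differentiable (by simp)) hK0 hK x (spacing (N n))
      have e : (φ x - φ (x + spacing (N n))) / spacing (N n) - -deriv φ x =
        -((φ (x + spacing (N n)) - φ x - spacing (N n) * deriv φ x) / spacing (N n)) := by
        field_simp; ring
      rw [e, abs_neg, abs_div, abs_of_pos hε, div_le_iff₀ hε]
      linarith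
  simp only [mul_neg, integral_neg] at h1
  refine h1.congr' ?_
  filter_upwards [hε0.eventually (gt_mem_nhds hδ)] with n hn
  refine (integral_fluxDiff_mul (hN2 n) (V n)
    (hφ.continuous.integrable_of_hasCompactSupport hc) fun x hx => ?_).symm
  have := hm x hx
  exact ⟨by linarith, by linarith⟩

end FluxDifference

/-! ### Pointwise recovery of derivatives by a measurable formula. -/

section RightDerivative

/-- The right derivative, as a limit along a sequence. -/
def rightDeriv (f : ℝ → ℝ) (x : ℝ) : ℝ :=
  limUnder atTop fun m : ℕ => ((m : ℝ) + 1) * (f (x + 1 / ((m : ℝ) + 1)) - f x)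

theorem rightDeriv_eq {f : ℝ → ℝ} {f' x : ℝ} (h : HasDerivWithinAt f f' (Ioi x) x) :
    rightDeriv f x = f' := by
  refine Tendsto.limUnder_eq ?_
  rw [hasDerivWithinAt_iff_tendsto_slope' (by simp)] at h
  have h1 : Tendsto (fun m : ℕ => x + 1 / ((m : ℝ) + 1)) atTop (𝓝[Ioi x] x) := by
    refine tendsto_nhdsWithin_iff.2 ⟨?_, Eventually.of_forall fun m => ?_⟩
    · simpa using (tendsto_one_div_add_atTop_nhds_zero_nat (𝕜 := ℝ)).const_add x
    · have : (0 : ℝ) < 1 / ((m : ℝ) + 1) := by positivity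
      simp only [mem_Ioi]; linarith
  refine (h.comp h1).congr fun m => ?_
  simp [slope_def_field, div_eq_inv_mul]

/-- `limUnder` of a sequence of measurable functions is measurable whether or not the limit exists
at each point; this is why derivatives are taken along a fixed sequence. -/
theorem measurable_rightDeriv {F : ℝ × ℝ → ℝ} (hF : Measurable F) :
    Measurable fun p : ℝ × ℝ => rightDeriv (fun y => F (y, p.2)) p.1 := by
  refine (StronglyMeasurable.limUnder (f := fun (m : ℕ) (p : ℝ × ℝ) =>
    ((m : ℝ) + 1) * (F (p.1 + 1 / ((m : ℝ) + 1), p.2) - F (p.1, p.2))) fun m => ?_).measurable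
  refine Measurable.stronglyMeasurable ?_
  fun_prop

theorem rightDeriv_congr {f g : ℝ → ℝ} {x : ℝ} (h : ∀ y, x ≤ y → f y = g y) :
    rightDeriv f x = rightDeriv g x := by
  unfold rightDeriv
  congr 1
  funext m
  rw [h x le_rfl, h _ (by simp; positivity)]

/-- Integrals of `g` over `(0,x)`, with `g` extended by zero outside `(0,1)`. -/
def primitive (g : ℝ → ℝ) (x : ℝ) : ℝ := ∫ y in (0 : ℝ)..x, (Ioo 0 1).indicator g y

theorem integrable_indicator_unit {g : ℝ → ℝ} (hg : MemLp g 2 unitVol) :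
    Integrable ((Ioo (0 : ℝ) 1).indicator g) :=
  (integrable_indicator_iff measurableSet_Ioo).2 (hg.integrable one_le_two)

theorem continuous_primitive {g : ℝ → ℝ} (hg : MemLp g 2 unitVol) : Continuous (primitive g) :=
  intervalIntegral.continuous_primitive
    (fun _ _ => (integrable_indicator_unit hg).intervalIntegrable) 0

theorem primitive_eq {g : ℝ → ℝ} {x : ℝ} (hx : x ∈ Icc (0 : ℝ) 1) :
    primitive g x = ∫ y in (0 : ℝ)..x, g y := by
  unfold primitive
  rw [intervalIntegral.integral_of_le hx.1, intervalIntegral.integral_of_le hx.1,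
    integral_Ioc_eq_integral_Ioo, integral_Ioc_eq_integral_Ioo]
  refine setIntegral_congr_fun measurableSet_Ioo fun y hy => ?_
  exact indicator_of_mem (Ioo_subset_Ioo_right hx.2 hy) _

/-- Values beyond `1` are needed because the right derivative is also evaluated at `x = 1`. -/
theorem primitive_eq_of_one_le {g : ℝ → ℝ} (hg : MemLp g 2 unitVol) {x : ℝ} (hx : 1 ≤ x) :
    primitive g x = ∫ y in (0 : ℝ)..1, g y := by
  rw [← primitive_eq ⟨zero_le_one, le_rfl⟩]
  unfold primitive
  rw [← intervalIntegral.integral_add_adjacent_intervals (b := 1)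
    (integrable_indicator_unit hg).intervalIntegrable
    (integrable_indicator_unit hg).intervalIntegrable]
  conv_rhs => rw [← add_zero (∫ y in (0 : ℝ)..1, (Ioo 0 1).indicator g y)]
  congr 1
  rw [intervalIntegral.integral_of_le hx]
  refine setIntegral_eq_zero_of_forall_eq_zero fun y hy => ?_
  exact indicator_of_notMem (fun h => by linarith [h.2, hy.1]) _

theorem ae_hasDerivAt_primitive {g : ℝ → ℝ} (hg : MemLp g 2 unitVol) :
    ∀ᵐ x ∂unitVol, HasDerivAt (primitive g) (g x) x := by
  have h := ae_restrict_of_ae (s := Ioo (0 : ℝ) 1) (_root_.LocallyIntegrable.ae_hasDerivAt_integral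
    (integrable_indicator_unit hg).locallyIntegrable)
  filter_upwards [h, ae_restrict_mem measurableSet_Ioo] with x hx hx1
  have := hx 0
  rwa [indicator_of_mem hx1] at this

end RightDerivative

/-! ### The limit at a fixed time. -/

section SingleTime

variable {N : ℕ → ℕ} {V : (n : ℕ) → Fin (N n + 1) → ℝ}

/-- The limit of the integrals of the discrete fluxes over `(0,x)`. -/
def potential (V : (n : ℕ) → Fin (N n + 1) → ℝ) (x : ℝ) : ℝ :=
  limUnder atTop fun n =>
    ∫ y, stepFn (N n) (bondFlux (N n) (V n)) y * (Ioo 0 x).indicator 1 y ∂unitVol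

/-- The piecewise derivative of the limit, recovered from the discrete fluxes. -/
def limDeriv (V : (n : ℕ) → Fin (N n + 1) → ℝ) (x : ℝ) : ℝ := 1 / 2 * rightDeriv (potential V) x

/-- The derivative of the piecewise derivative of the limit. -/
def limDeriv2 (V : (n : ℕ) → Fin (N n + 1) → ℝ) (x : ℝ) : ℝ := rightDeriv (limDeriv V) x

theorem potential_eq {Z : ℝ → ℝ}
    (hZ : WeakTendsto unitVol (fun n => stepFn (N n) (bondFlux (N n) (V n))) atTop Z)
    {x : ℝ} (hx : 0 ≤ x) : potential V x = primitive Z x := by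
  unfold potential
  rw [(hZ _ (memLp_indicator_Ioo 0 x)).limUnder_eq, primitive,
    intervalIntegral.integral_of_le hx, integral_Ioc_eq_integral_Ioo,
    setIntegral_indicator measurableSet_Ioo]
  have : (fun y => Z y * (Ioo 0 x).indicator 1 y) = (Ioo 0 x).indicator Z := by
    funext y
    by_cases hy : y ∈ Ioo 0 x <;> simp [hy]
  rw [this, setIntegral_indicator measurableSet_Ioo, inter_comm]

theorem ae_limDeriv_eq {g : ℝ → ℝ} (hg : MemLp g 2 unitVol)
    (hZ : WeakTendsto unitVol (fun n => stepFn (N n) (bondFlux (N n) (V n))) atTop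
      (fun x => 2 * g x)) :
    ∀ᵐ x ∂unitVol, limDeriv V x = g x := by
  filter_upwards [ae_hasDerivAt_primitive (hg.const_mul 2), ae_restrict_mem measurableSet_Ioo]
    with x hx hx1
  unfold limDeriv
  rw [rightDeriv_congr fun y hy => potential_eq hZ (hx1.1.le.trans hy),
    rightDeriv_eq hx.hasDerivWithinAt]
  ring

theorem IsPiecewiseH1With.congr {f g g' : ℝ → ℝ} (h : IsPiecewiseH1With f g)
    (hg : g =ᵐ[unitVol] g') : IsPiecewiseH1With f g' := by
  obtain ⟨h1, h2, P, hP⟩ := h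
  refine ⟨h1, h2.ae_eq hg, P, fun φ hφ hc hs => ?_⟩
  rw [hP φ hφ hc hs, setIntegral_diff_finset, setIntegral_diff_finset]
  congr 1
  refine integral_congr_ae ?_
  filter_upwards [hg] with x hx
  rw [hx]

theorem limDeriv_spec (hN2 : ∀ n, 2 ≤ N n) (hN : Tendsto N atTop atTop)
    {M C : ℝ} (hM : ∀ n, energy (N n) (V n) ≤ M)
    (hC : ∀ n i, |V n i| ≤ C) {f : ℝ → ℝ} (hf2 : MemLp f 2 unitVol)
    (hf : WeakTendsto unitVol (fun n => interp (N n) (V n)) atTop f) :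
    ∫ x, limDeriv V x ^ 2 ∂unitVol ≤ M ∧ IsPiecewiseH1With f (limDeriv V) ∧
      WeakTendsto unitVol (fun n => stepFn (N n) (bondFlux (N n) (V n))) atTop
        (fun x => 2 * limDeriv V x) := by
  obtain ⟨g, hgM, hg, hZ⟩ := exists_piecewise_deriv hN2 hN hM hC hf2 hf
  have hae := ae_limDeriv_eq hg.2.1 hZ
  refine ⟨?_, hg.congr (hae.mono fun _ h => h.symm), fun φ hφ => ?_⟩
  · refine le_of_eq_of_le (integral_congr_ae ?_) hgM
    filter_upwards [hae] with x hx
    rw [hx]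
  · have : ∫ x, 2 * limDeriv V x * φ x ∂unitVol = ∫ x, 2 * g x * φ x ∂unitVol := by
      refine integral_congr_ae ?_
      filter_upwards [hae] with x hx
      rw [hx]
    rw [this]
    exact hZ φ hφ

/-- Regularity and boundary conditions at the times of bounded dissipation. -/
theorem limDeriv_spec_of_dissipation (hN2 : ∀ n, 2 ≤ N n) (hN : Tendsto N atTop atTop)
    {M C R : ℝ} (hM : ∀ n, energy (N n) (V n) ≤ M)
    (hC : ∀ n i, |V n i| ≤ C) {f : ℝ → ℝ} (hf2 : MemLp f 2 unitVol)
    (hf : Tendsto (fun n => eLpNorm (fun x => interp (N n) (V n) x - f x) 2 unitVol) atTop (𝓝 0))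
    (hR : ∃ᶠ n in atTop, dissipation (N n) (V n) ≤ R) :
    IsH1With (limDeriv V) (limDeriv2 V) ∧ ContinuousOn (limDeriv V) (Icc 0 1) ∧
      limDeriv V 0 = 0 ∧ limDeriv V 1 = 0 ∧ (∀ x ∈ jumpSet f, limDeriv V x = 0) ∧
      ∫ x, limDeriv2 V x ^ 2 ∂unitVol ≤ R / 4 := by
  -- The dissipation is bounded only for infinitely many `n`; an ultrafilter containing this set of
  -- indices suffices, since the flux limit is already known along the whole sequence.
  have hne : NeBot (atTop ⊓ 𝓟 {n | dissipation (N n) (V n) ≤ R}) :=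
    frequently_mem_iff_neBot.1 hR
  set 𝒰 := Ultrafilter.of (atTop ⊓ 𝓟 {n | dissipation (N n) (V n) ≤ R})
  have h𝒰 : (𝒰 : Filter ℕ) ≤ atTop := (Ultrafilter.of_le _).trans inf_le_left
  have hR𝒰 : ∀ᶠ n in 𝒰, dissipation (N n) (V n) ≤ R :=
    (Ultrafilter.of_le _).trans inf_le_right (mem_principal_self _)
  obtain ⟨-, hpw, hflux⟩ := limDeriv_spec hN2 hN hM hC hf2
    (weakTendsto_of_tendsto_eLpNorm (fun n => memLp_interp (hN2 n) (V n) 2) hf2 hf)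
  have hl2 : MemLp (limDeriv V) 2 unitVol := hpw.2.1
  obtain ⟨W, hW2, hWR, hW⟩ := exists_weakTendsto 𝒰
    (fun n => memLp_stepFn (hN2 n) (fluxDiff (N n) (V n)) 2)
    (hR𝒰.mono fun n hn => (integral_fluxDiff_sq_le (hN2 n) (V n)).trans hn)
  obtain ⟨-, hG⟩ := weakTendsto_bondFlux hN2 hN h𝒰 hR𝒰 hW hW2
  have hW1 := integral_limit_flux_eq_zero hN2 hN h𝒰 hR𝒰 hW
  have hzero : ∀ x ∉ Ioo (0 : ℝ) 1, 0 ≤ x → primitive W x = 0 := by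
    intro x hx hx0
    rcases eq_or_lt_of_le hx0 with rfl | hx0
    · simp [primitive]
    · rw [primitive_eq_of_one_le hW2 (not_lt.1 fun h => hx ⟨hx0, h⟩), hW1]
  -- The potential is thus the primitive of a continuous function, so its right derivative exists at
  -- every `x ≥ 0` and `limDeriv V` has meaningful values at `0`, `1` and the jump points.
  have hpot : ∀ x, 0 ≤ x → potential V x = ∫ y in (0 : ℝ)..x, primitive W y := by
    intro x hx
    have h1 := (hflux _ (memLp_indicator_Ioo 0 x)).mono_left h𝒰
    have h2 := tendsto_nhds_unique h1 (hG _ (memLp_indicator_Ioo 0 x))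
    have h3 : potential V x = _ := (hflux _ (memLp_indicator_Ioo 0 x)).limUnder_eq
    rw [h3, h2, intervalIntegral.integral_of_le hx, integral_Ioc_eq_integral_Ioo]
    have e1 : (fun y => (∫ z in (0 : ℝ)..y, W z) * (Ioo 0 x).indicator 1 y) =
        (Ioo 0 x).indicator (fun y => ∫ z in (0 : ℝ)..y, W z) := by
      funext y
      by_cases hy : y ∈ Ioo 0 x <;> simp [hy]
    rw [e1, setIntegral_indicator measurableSet_Ioo, inter_comm,
      ← setIntegral_indicator measurableSet_Ioo]
    refine setIntegral_congr_fun measurableSet_Ioo fun y hy => ?_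
    by_cases hy1 : y ∈ Ioo (0 : ℝ) 1
    · simp only [hy1, indicator_of_mem]
      rw [primitive_eq (Ioo_subset_Icc_self hy1)]
    · simp only [hy1, not_false_iff, indicator_of_notMem]
      rw [hzero y hy1 hy.1.le]
  have hlim : ∀ x, 0 ≤ x → limDeriv V x = 1 / 2 * primitive W x := by
    intro x hx
    have hder : HasDerivAt (fun x => ∫ y in (0 : ℝ)..x, primitive W y) (primitive W x) x :=
      intervalIntegral.integral_hasDerivAt_right
        ((continuous_primitive hW2).intervalIntegrable _ _)
        ((continuous_primitive hW2).stronglyMeasurableAtFilter _ _)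
        (continuous_primitive hW2).continuousAt
    unfold limDeriv
    rw [rightDeriv_congr fun y hy => hpot y (hx.trans hy), rightDeriv_eq hder.hasDerivWithinAt]
  have hlim2 : ∀ᵐ x ∂unitVol, limDeriv2 V x = 1 / 2 * W x := by
    filter_upwards [ae_hasDerivAt_primitive hW2, ae_restrict_mem measurableSet_Ioo] with x hx hx1
    unfold limDeriv2
    rw [rightDeriv_congr fun y hy => hlim y (hx1.1.le.trans hy),
      rightDeriv_eq (hx.const_mul (1 / 2)).hasDerivWithinAt]
  have hl22 : MemLp (limDeriv2 V) 2 unitVol :=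
    (hW2.const_mul (1 / 2)).ae_eq (hlim2.mono fun _ h => h.symm)
  refine ⟨⟨hl2, hl22, fun φ hφ hc hs => ?_⟩, ?_, ?_, ?_, fun x hx => ?_, ?_⟩
  · have h1 := tendsto_integral_fluxDiff_mul hN2 hN hM h𝒰
      (fun ψ hψ => (hflux ψ hψ).mono_left h𝒰) hφ hc hs
    have h2 := tendsto_nhds_unique h1
      (hW φ (memLp_unitVol_of_continuous hφ.continuous hc))
    have h3 : ∫ x, limDeriv2 V x * φ x ∂unitVol = 1 / 2 * ∫ x, W x * φ x ∂unitVol := by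
      rw [← integral_const_mul]
      refine integral_congr_ae ?_
      filter_upwards [hlim2] with x hx
      rw [hx]; ring
    simp only [mul_assoc, integral_const_mul] at h2
    change ∫ x, limDeriv V x * deriv φ x ∂unitVol = - ∫ x, limDeriv2 V x * φ x ∂unitVol
    linarith
  · exact ((continuous_const.mul (continuous_primitive hW2)).continuousOn).congr
      fun x hx => hlim x hx.1
  · rw [hlim 0 le_rfl, hzero 0 (by simp) le_rfl, mul_zero]
  · rw [hlim 1 zero_le_one, hzero 1 (by simp) zero_le_one, mul_zero]
  · rw [hlim x hx.1.1.le, primitive_eq (Ioo_subset_Icc_self hx.1),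
      limit_flux_eq_zero_of_mem_jumpSet hN2 hN hM hf2.1 hf h𝒰 hR𝒰 hW hx, mul_zero]
  · have : ∫ x, limDeriv2 V x ^ 2 ∂unitVol = 1 / 4 * ∫ x, W x ^ 2 ∂unitVol := by
      rw [← integral_const_mul]
      refine integral_congr_ae ?_
      filter_upwards [hlim2] with x hx
      rw [hx]; ring
    rw [this]; linarith

end SingleTime

/-! ### Joint measurability in space and time. -/

section Measurability

variable {N : ℕ → ℕ}

/-- The states of the discrete movements at time `t`. -/
def stateAt (τ : ℕ → ℝ) (U : (n : ℕ) → ℕ → Fin (N n + 1) → ℝ) (t : ℝ) (n : ℕ) :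
    Fin (N n + 1) → ℝ := U n ⌊t / τ n⌋₊

theorem measurable_floor_floor (F : ℕ → ℕ → ℝ) {α : Type*} [MeasurableSpace α] {f g : α → ℝ}
    (hf : Measurable f) (hg : Measurable g) : Measurable fun a => F ⌊f a⌋₊ ⌊g a⌋₊ :=
  (Measurable.of_discrete (f := fun p : ℕ × ℕ => F p.1 p.2)).comp
    ((Nat.measurable_floor.comp hf).prodMk (Nat.measurable_floor.comp hg))

theorem measurable_potential (τ : ℕ → ℝ) (U : (n : ℕ) → ℕ → Fin (N n + 1) → ℝ) :
    Measurable fun p : ℝ × ℝ => potential (stateAt τ U p.2) p.1 := by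
  refine (StronglyMeasurable.limUnder fun n => ?_).measurable
  refine StronglyMeasurable.integral_prod_right (Measurable.stronglyMeasurable ?_)
  have h1 : Measurable fun q : (ℝ × ℝ) × ℝ =>
      stepFn (N n) (bondFlux (N n) (stateAt τ U q.1.2 n)) q.2 :=
    measurable_floor_floor (fun k i => bondFlux (N n) (U n k) i)
      (measurable_fst.snd.div_const _) (measurable_snd.div_const _)
  have h2 : Measurable fun q : (ℝ × ℝ) × ℝ => (Ioo 0 q.1.1).indicator (1 : ℝ → ℝ) q.2 := by
    have hs : MeasurableSet {q : (ℝ × ℝ) × ℝ | 0 < q.2 ∧ q.2 < q.1.1} :=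
      (measurableSet_lt measurable_const measurable_snd).inter
        (measurableSet_lt measurable_snd measurable_fst.fst)
    exact (measurable_const (a := (1 : ℝ))).indicator hs
  exact h1.mul h2

theorem measurable_limDeriv (τ : ℕ → ℝ) (U : (n : ℕ) → ℕ → Fin (N n + 1) → ℝ) :
    Measurable fun p : ℝ × ℝ => limDeriv (stateAt τ U p.2) p.1 :=
  (measurable_rightDeriv (F := fun p => potential (stateAt τ U p.2) p.1)
    (measurable_potential τ U)).const_mul (1 / 2)

theorem measurable_limDeriv2 (τ : ℕ → ℝ) (U : (n : ℕ) → ℕ → Fin (N n + 1) → ℝ) :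
    Measurable fun p : ℝ × ℝ => limDeriv2 (stateAt τ U p.2) p.1 :=
  measurable_rightDeriv (F := fun p => limDeriv (stateAt τ U p.2) p.1) (measurable_limDeriv τ U)

end Measurability

theorem memLp_prod_of_slices {w : ℝ × ℝ → ℝ} (hw : Measurable w) {Φ : ℝ → ENNReal} {T : ℝ}
    (h : ∀ᵐ t ∂volume.restrict (Ioo 0 T), MemLp (fun x => w (x, t)) 2 unitVol ∧
      ENNReal.ofReal (∫ x, w (x, t) ^ 2 ∂unitVol) ≤ Φ t)
    (hΦ : ∫⁻ t in Ioo 0 T, Φ t ≠ ⊤) :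
    MemLp w 2 (volume.restrict (Ioo (0 : ℝ) 1 ×ˢ Ioo (0 : ℝ) T)) := by
  rw [memLp_two_iff_integrable_sq hw.aestronglyMeasurable]
  refine ⟨(hw.pow_const 2).aestronglyMeasurable, ?_⟩
  rw [hasFiniteIntegral_iff_ofReal (Eventually.of_forall fun _ => sq_nonneg _),
    Measure.volume_eq_prod, ← Measure.prod_restrict,
    lintegral_prod_symm _ (hw.pow_const 2).ennreal_ofReal.aemeasurable]
  refine lt_of_le_of_lt (lintegral_mono_ae ?_) (lt_top_iff_ne_top.2 hΦ)
  filter_upwards [h] with t ht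
  refine le_of_eq_of_le ?_ ht.2
  exact (ofReal_integral_eq_lintegral_ofReal ht.1.integrable_sq
    (Eventually.of_forall fun _ => sq_nonneg _)).symm

/-! ### Bounds on the limit and Fatou's lemma for the dissipation. -/

section Solution

variable {N : ℕ → ℕ} {τ : ℕ → ℝ} {U : (n : ℕ) → ℕ → Fin (N n + 1) → ℝ}

theorem abs_le_of_tendsto_eLpNorm (hN2 : ∀ n, 2 ≤ N n) {V : (n : ℕ) → Fin (N n + 1) → ℝ} {C : ℝ}
    (hC : ∀ n i, |V n i| ≤ C) {f : ℝ → ℝ} (hfm : AEStronglyMeasurable f unitVol)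
    (hf : Tendsto (fun n => eLpNorm (fun x => interp (N n) (V n) x - f x) 2 unitVol)
      atTop (𝓝 0)) : ∀ᵐ x ∂unitVol, |f x| ≤ C := by
  have hmeas : TendstoInMeasure unitVol (fun n => interp (N n) (V n)) atTop f :=
    tendstoInMeasure_of_tendsto_eLpNorm two_ne_zero
      (fun n => (memLp_interp (hN2 n) (V n) 2).1) hfm hf
  obtain ⟨ns, -, hae⟩ := hmeas.exists_seq_tendsto_ae
  filter_upwards [hae] with x hx
  exact le_of_tendsto hx.abs (Eventually.of_forall fun k => hC _ _)

theorem lintegral_liminf_dissipation_le {u₀ : (n : ℕ) → Fin (N n + 1) → ℝ}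
    (hU : ∀ n, IsDiscreteMovement (N n) (τ n) (u₀ n) (U n)) (hN2 : ∀ n, 2 ≤ N n)
    (hτpos : ∀ n, 0 < τ n) {M : ℝ} (hM : ∀ n, energy (N n) (u₀ n) ≤ M) (T : ℝ) :
    ∫⁻ t in Ioo 0 T, liminf (fun n => ENNReal.ofReal (dissipationAt (N n) (τ n) (U n) t)) atTop ≤
      ENNReal.ofReal (2 * M) := by
  refine (lintegral_liminf_le fun n => (measurable_dissipationAt _ _ _).ennreal_ofReal).trans ?_
  refine (liminf_le_liminf (Eventually.of_forall fun n =>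
    (hU n).lintegral_dissipationAt_le (hN2 n) (hτpos n) (hM n) T)).trans ?_
  simp

/-- A fixed `t > 0` eventually lies beyond the first time step, where `dissipationAt` is the actual
dissipation. -/
theorem frequently_dissipation_le (hτpos : ∀ n, 0 < τ n) (hτ : Tendsto τ atTop (𝓝 0)) {t : ℝ}
    (ht : 0 < t) {R : ℝ} (hR : liminf (fun n =>
      ENNReal.ofReal (dissipationAt (N n) (τ n) (U n) t)) atTop < ENNReal.ofReal R) :
    ∃ᶠ n in atTop, dissipation (N n) (stateAt τ U t n) ≤ R := by
  refine ((frequently_lt_of_liminf_lt (by isBoundedDefault) hR).and_eventually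
    (hτ.eventually (gt_mem_nhds ht))).mono fun n hn => ?_
  have := (ENNReal.ofReal_lt_ofReal_iff'.1 hn.1).1
  rw [dissipationAt_of_le (hτpos n) hn.2.le] at this
  exact this.le

end Solution

/-! ### Test functions in space-time. -/

section TestFunctions

theorem exists_margin_prod {ψ : ℝ × ℝ → ℝ} (hc : HasCompactSupport ψ)
    (hs : tsupport ψ ⊆ Ioo (0 : ℝ) 1 ×ˢ Ioi (0 : ℝ)) :
    ∃ δ > 0, ∃ T > 0, ∀ p ∈ tsupport ψ, δ < p.1 ∧ p.1 < 1 - δ ∧ δ < p.2 ∧ p.2 < T := by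
  obtain ⟨δ, hδ, hsub⟩ := hc.exists_thickening_subset_open (isOpen_Ioo.prod isOpen_Ioi) hs
  obtain ⟨T, hT⟩ := hc.isBounded.exists_norm_le
  refine ⟨δ / 2, by positivity, |T| + 1, by positivity, fun p hp => ?_⟩
  have hmem : ∀ a b : ℝ, |a| ≤ δ / 2 → |b| ≤ δ / 2 →
      (p.1 + a, p.2 + b) ∈ Ioo (0 : ℝ) 1 ×ˢ Ioi (0 : ℝ) := fun a b ha hb => by
    refine hsub (Metric.mem_thickening_iff.2 ⟨p, hp, ?_⟩)
    rw [Prod.dist_eq, max_lt_iff, Real.dist_eq, Real.dist_eq]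
    constructor
    · simp only [add_sub_cancel_left]; linarith
    · simp only [add_sub_cancel_left]; linarith
  have hh : |(-(δ / 2))| ≤ δ / 2 := by rw [abs_neg, abs_of_pos (by positivity)]
  have hh' : |δ / 2| ≤ δ / 2 := by rw [abs_of_pos (by positivity)]
  have h1 := hmem _ _ hh hh
  have h2 := hmem _ _ hh' hh'
  simp only [mem_prod, mem_Ioo, mem_Ioi] at h1 h2
  have h3 : p.2 ≤ T := (le_abs_self _).trans ((norm_snd_le p).trans (hT p hp))
  exact ⟨by linarith, by linarith, by linarith, by linarith [le_abs_self T]⟩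

variable {ψ : ℝ × ℝ → ℝ}

theorem deriv_snd_eq (hψ : ContDiff ℝ ∞ ψ) (x t : ℝ) :
    deriv (fun s => ψ (x, s)) t = fderiv ℝ ψ (x, t) (0, 1) := by
  have h1 : HasDerivAt (fun s : ℝ => (x, s)) ((0 : ℝ), (1 : ℝ)) t :=
    (hasDerivAt_const t x).prodMk (hasDerivAt_id t)
  exact ((hψ.differentiable (by simp) (x, t)).hasFDerivAt.comp_hasDerivAt t h1).deriv

theorem exists_lipschitz (hψ : ContDiff ℝ ∞ ψ) (hc : HasCompactSupport ψ) :
    ∃ K, 0 ≤ K ∧ ∀ p q, |ψ p - ψ q| ≤ K * dist p q := by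
  obtain ⟨K, hK⟩ := ContDiff.lipschitzWith_of_hasCompactSupport hc hψ (by simp)
  exact ⟨K, K.2, fun p q => by simpa [Real.dist_eq] using hK.dist_le_mul p q⟩

theorem continuous_deriv_snd (hψ : ContDiff ℝ ∞ ψ) :
    Continuous fun p : ℝ × ℝ => deriv (fun s => ψ (p.1, s)) p.2 := by
  simp only [deriv_snd_eq hψ]
  exact (hψ.continuous_fderiv (by simp)).clm_apply continuous_const

theorem deriv_snd_eq_zero (hψ : ContDiff ℝ ∞ ψ) {p : ℝ × ℝ} (hp : p ∉ tsupport ψ) :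
    deriv (fun s => ψ (p.1, s)) p.2 = 0 := by
  have : fderiv ℝ ψ p = 0 := by
    by_contra h
    exact hp (support_fderiv_subset ℝ h)
  rw [deriv_snd_eq hψ, this, zero_apply]

theorem hasCompactSupport_deriv_snd (hψ : ContDiff ℝ ∞ ψ) (hc : HasCompactSupport ψ) :
    HasCompactSupport fun p : ℝ × ℝ => deriv (fun s => ψ (p.1, s)) p.2 :=
  HasCompactSupport.intro hc fun _ hp => deriv_snd_eq_zero hψ hp

theorem exists_lipschitz_deriv_snd (hψ : ContDiff ℝ ∞ ψ) (hc : HasCompactSupport ψ) :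
    ∃ K, 0 ≤ K ∧ ∀ x s t,
      |deriv (fun s => ψ (x, s)) s - deriv (fun s => ψ (x, s)) t| ≤ K * |s - t| := by
  have h1 : ContDiff ℝ ∞ (fun p : ℝ × ℝ => deriv (fun s => ψ (p.1, s)) p.2) := by
    simp only [deriv_snd_eq hψ]
    exact (hψ.fderiv_right (m := ∞) (by simp)).clm_apply contDiff_const
  obtain ⟨K, hK0, hK⟩ := exists_lipschitz h1 (hasCompactSupport_deriv_snd hψ hc)
  refine ⟨K, hK0, fun x s t => ?_⟩
  have := hK (x, s) (x, t)
  rwa [Prod.dist_eq, dist_self, Real.dist_eq, max_eq_right (abs_nonneg _)] at this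

theorem integrable_mul_test {w : ℝ × ℝ → ℝ} {T : ℝ}
    (hw : MemLp w 2 (volume.restrict (Ioo (0 : ℝ) 1 ×ˢ Ioo (0 : ℝ) T))) {g : ℝ × ℝ → ℝ}
    (hg : Continuous g) (hgc : HasCompactSupport g) (hgT : ∀ p, g p ≠ 0 → 0 < p.2 ∧ p.2 < T) :
    IntegrableOn (fun p => w p * g p) (Ioo (0 : ℝ) 1 ×ˢ Ioi (0 : ℝ)) := by
  have h1 : IntegrableOn (fun p => w p * g p) (Ioo (0 : ℝ) 1 ×ˢ Ioo (0 : ℝ) T) :=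
    integrable_mul_of_memLp hw ((hg.memLp_of_hasCompactSupport hgc).restrict _)
  refine h1.of_forall_sdiff_eq_zero (measurableSet_Ioo.prod measurableSet_Ioi) fun p hp => ?_
  by_contra h
  obtain ⟨h2, h3⟩ := hgT p (right_ne_zero_of_mul h)
  exact hp.2 ⟨hp.1.1, h2, h3⟩

theorem setIntegral_prod_eq {f : ℝ × ℝ → ℝ}
    (hf : IntegrableOn f (Ioo (0 : ℝ) 1 ×ˢ Ioi (0 : ℝ))) :
    ∫ p in Ioo (0 : ℝ) 1 ×ˢ Ioi (0 : ℝ), f p = ∫ t in Ioi 0, ∫ x, f (x, t) ∂unitVol := by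
  unfold IntegrableOn at hf
  rw [Measure.volume_eq_prod, ← Measure.prod_restrict] at hf ⊢
  exact integral_prod_symm f hf

end TestFunctions

/-! ### The weak discrete equation and its limit. -/

theorem stronglyMeasurable_slice_integral (F : ℕ → ℕ → ℝ) (s τ ε : ℝ) {g : ℝ × ℝ → ℝ}
    (hg : Continuous g) :
    StronglyMeasurable fun t => ∫ x, F ⌊(t - s) / τ⌋₊ ⌊x / ε⌋₊ * g (x, t) ∂unitVol := by
  refine StronglyMeasurable.integral_prod_right (Measurable.stronglyMeasurable ?_)
  exact (measurable_floor_floor F ((measurable_fst.sub_const s).div_const τ)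
    (measurable_snd.div_const ε)).mul (hg.measurable.comp measurable_swap)

theorem exists_slice_support {g : ℝ × ℝ → ℝ} (hgc : HasCompactSupport g) :
    ∃ T : ℝ, ∀ p, g p ≠ 0 → p.2 ∈ Icc (-T) T := by
  obtain ⟨T, hT⟩ := hgc.isBounded.exists_norm_le
  exact ⟨T, fun p hp => abs_le.1 ((norm_snd_le p).trans (hT p (subset_tsupport _ hp)))⟩

theorem integrable_slice_integral {F : ℕ → ℕ → ℝ} {C : ℝ} (hF : ∀ k i, |F k i| ≤ C) (s τ ε : ℝ)
    {g : ℝ × ℝ → ℝ} (hg : Continuous g) (hgc : HasCompactSupport g) :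
    Integrable fun t => ∫ x, F ⌊(t - s) / τ⌋₊ ⌊x / ε⌋₊ * g (x, t) ∂unitVol := by
  obtain ⟨T, hT⟩ := exists_slice_support hgc
  obtain ⟨B, hB⟩ := hgc.exists_bound_of_continuous hg
  have hC0 : 0 ≤ C := (abs_nonneg _).trans (hF 0 0)
  have hbound : Integrable ((Icc (-T) T).indicator fun _ => C * B) :=
    (integrable_indicator_iff measurableSet_Icc).2 (integrableOn_const (by simp))
  refine hbound.mono' (stronglyMeasurable_slice_integral F s τ ε hg).aestronglyMeasurable
    (Eventually.of_forall fun t => ?_)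
  by_cases ht : t ∈ Icc (-T) T
  · rw [indicator_of_mem ht]
    refine (norm_integral_le_of_norm_le_const (C := C * B) (Eventually.of_forall fun x => ?_)).trans
      (by simp)
    rw [norm_mul]
    exact mul_le_mul (hF _ _) (hB _) (norm_nonneg _) hC0
  · rw [indicator_of_notMem ht]
    have : ∀ x, g (x, t) = 0 := fun x => by
      by_contra h
      exact ht (hT _ h)
    simp [this]

theorem integrable_interp_mul {N : ℕ} (h2 : 2 ≤ N) (v : Fin (N + 1) → ℝ) {g : ℝ → ℝ}
    (hg : MemLp g 2 unitVol) : Integrable (fun x => interp N v x * g x) unitVol :=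
  integrable_mul_of_memLp (memLp_interp h2 v 2) hg

theorem memLp_slice {g : ℝ × ℝ → ℝ} (hg : Continuous g) (hgc : HasCompactSupport g) (t : ℝ) :
    MemLp (fun x => g (x, t)) 2 unitVol := by
  obtain ⟨B, hB⟩ := hgc.exists_bound_of_continuous hg
  exact MemLp.of_bound (hg.comp (by fun_prop)).aestronglyMeasurable B
    (Eventually.of_forall fun x => hB _)

/-- The discrete equation in weak form. -/
theorem IsDiscreteMovement.integral_eq {N : ℕ} {τ : ℝ} {u₀ : Fin (N + 1) → ℝ}
    {U : ℕ → Fin (N + 1) → ℝ} (hU : IsDiscreteMovement N τ u₀ U) (h2 : 2 ≤ N) (hτ : 0 < τ)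
    {C : ℝ} (hC : ∀ k i, |U k i| ≤ C) {ψ : ℝ × ℝ → ℝ} (hψ : Continuous ψ)
    (hc : HasCompactSupport ψ) (hs : ∀ p, ψ p ≠ 0 → τ < p.2) :
    ∫ t in Ioi 0, ∫ x, interp N (U ⌊t / τ⌋₊) x * ((ψ (x, t + τ) - ψ (x, t)) / τ) ∂unitVol =
      - ∫ t in Ioi 0, ∫ x, stepFn N (fluxDiff N (U ⌊t / τ⌋₊)) x * ψ (x, t) ∂unitVol := by
  set I : ℝ → ℝ := fun t => ∫ x, interp N (U ⌊(t - 0) / τ⌋₊) x * ψ (x, t) ∂unitVol with hI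
  -- `I` and `J` test the current and the preceding state at time `t`. By translation invariance the
  -- left side is `(∫ J - ∫ I)/τ`; for `t ≤ τ`, where the preceding state is meaningless, `ψ`
  -- vanishes.
  set J : ℝ → ℝ := fun t => ∫ x, interp N (U ⌊(t - τ) / τ⌋₊) x * ψ (x, t) ∂unitVol with hJ
  have hIi : Integrable I := integrable_slice_integral
    (F := fun k i => nodal N (U k) i) (fun k i => hC k _) 0 τ (spacing N) hψ hc
  have hJi : Integrable J := integrable_slice_integral
    (F := fun k i => nodal N (U k) i) (fun k i => hC k _) τ τ (spacing N) hψ hc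
  have hz : ∀ x t, t ≤ τ → ψ (x, t) = 0 := fun x t ht => by
    by_contra h
    exact absurd (hs _ h) (not_lt.2 ht)
  have eA : ∀ t, ∫ x, interp N (U ⌊t / τ⌋₊) x * ((ψ (x, t + τ) - ψ (x, t)) / τ) ∂unitVol =
      (J (t + τ) - I t) / τ := by
    intro t
    simp only [hI, hJ, add_sub_cancel_right, sub_zero]
    rw [← integral_sub (integrable_interp_mul h2 _ (memLp_slice hψ hc _))
      (integrable_interp_mul h2 _ (memLp_slice hψ hc _)), ← integral_div]
    refine integral_congr_ae (Eventually.of_forall fun x => ?_)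
    ring
  have eB : ∀ t, ∫ x, stepFn N (fluxDiff N (U ⌊t / τ⌋₊)) x * ψ (x, t) ∂unitVol =
      (I t - J t) / τ := by
    intro t
    simp only [hI, hJ, sub_zero]
    rcases le_or_gt t τ with ht | ht
    · simp [hz _ t ht]
    · rw [← integral_sub (integrable_interp_mul h2 _ (memLp_slice hψ hc _))
        (integrable_interp_mul h2 _ (memLp_slice hψ hc _)), ← integral_div]
      refine integral_congr_ae ?_
      filter_upwards [ae_restrict_mem measurableSet_Ioo] with x hx
      have hfl := floor_add_div hτ (sub_nonneg.2 ht.le)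
      rw [sub_add_cancel] at hfl
      have h := hU.nodal_sub h2 hτ ⌊(t - τ) / τ⌋₊ (floor_lt_of_lt_one h2 hx.2).le
      simp only [interp_eq_stepFn, stepFn]
      rw [hfl, eq_div_iff hτ.ne', ← sub_mul, h]
      ring
  have hA0 : ∀ t ∉ Ioi (0 : ℝ), (J (t + τ) - I t) / τ = 0 := by
    intro t ht
    rw [← eA]
    have h0 : t ≤ 0 := not_lt.1 ht
    simp [hz _ t (h0.trans hτ.le), hz _ (t + τ) (by linarith)]
  have hB0 : ∀ t ∉ Ioi (0 : ℝ), (I t - J t) / τ = 0 := by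
    intro t ht
    rw [← eB]
    have h0 : t ≤ 0 := not_lt.1 ht
    simp [hz _ t (h0.trans hτ.le)]
  simp only [eA, eB]
  rw [setIntegral_eq_integral_of_forall_compl_eq_zero hA0,
    setIntegral_eq_integral_of_forall_compl_eq_zero hB0, integral_div, integral_div,
    integral_sub (hJi.comp_add_right τ) hIi, integral_sub hIi hJi,
    integral_add_right_eq_self J τ]
  ring

theorem isDistribSolution_of_limit {N : ℕ → ℕ} (hN2 : ∀ n, 2 ≤ N n) (hN : Tendsto N atTop atTop)
    {τ : ℕ → ℝ} (hτpos : ∀ n, 0 < τ n) (hτ : Tendsto τ atTop (𝓝 0))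
    {u₀ : (n : ℕ) → Fin (N n + 1) → ℝ} {U : (n : ℕ) → ℕ → Fin (N n + 1) → ℝ}
    (hU : ∀ n, IsDiscreteMovement (N n) (τ n) (u₀ n) (U n))
    {C : ℝ} (hC : ∀ n k i, |U n k i| ≤ C) {M : ℝ} (hM : ∀ n k, energy (N n) (U n k) ≤ M)
    {u ux uxx : ℝ → ℝ → ℝ} (hu2 : IsL2Local u) (huxx2 : IsL2Local uxx)
    (hlim : ∀ t, 0 ≤ t →
      WeakTendsto unitVol (fun n => interp (N n) (stateAt τ U t n)) atTop (fun x => u x t))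
    (hflux : ∀ t, 0 ≤ t →
      WeakTendsto unitVol (fun n => stepFn (N n) (bondFlux (N n) (stateAt τ U t n))) atTop
        (fun x => 2 * ux x t))
    (hH1 : ∀ᵐ t ∂volume.restrict (Ioi (0 : ℝ)),
      IsH1With (fun x => ux x t) (fun x => uxx x t)) :
    IsDistribSolution u uxx := by
  intro ψ hψ hc hs
  obtain ⟨δ, hδ, T, hT0, hm⟩ := exists_margin_prod hc hs
  obtain ⟨K₁, hK₁0, hK₁⟩ := exists_lipschitz hψ hc
  obtain ⟨K₂, hK₂0, hK₂⟩ := exists_lipschitz_deriv_snd hψ hc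
  have hm' : ∀ p, ψ p ≠ 0 → δ < p.1 ∧ p.1 < 1 - δ ∧ δ < p.2 ∧ p.2 < T :=
    fun p hp => hm p (subset_tsupport _ hp)
  have hC0 : 0 ≤ C := (abs_nonneg _).trans (hC 0 0 0)
  have hcont_t := continuous_deriv_snd hψ
  have hcs_t := hasCompactSupport_deriv_snd hψ hc
  have hslice : ∀ t, ContDiff ℝ ∞ fun x => ψ (x, t) := fun t =>
    hψ.comp (contDiff_id.prodMk contDiff_const)
  have hslice_s : ∀ t, Function.support (fun x => ψ (x, t)) ⊆ Icc δ (1 - δ) := fun t x hx =>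
    ⟨(hm' (x, t) hx).1.le, (hm' (x, t) hx).2.1.le⟩
  have hslice_c : ∀ t, HasCompactSupport fun x => ψ (x, t) := fun t =>
    HasCompactSupport.of_support_subset_isCompact isCompact_Icc (hslice_s t)
  have hslice_t : ∀ t, tsupport (fun x => ψ (x, t)) ⊆ Ioo 0 1 := fun t =>
    (closure_minimal (hslice_s t) isClosed_Icc).trans fun x hx =>
      ⟨by linarith [hx.1], by linarith [hx.2]⟩
  have hdiff_t : ∀ x, Differentiable ℝ fun s => ψ (x, s) := fun x =>
    (hψ.comp (contDiff_const.prodMk contDiff_id) : ContDiff ℝ ∞ fun s => ψ (x, s)).differentiable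
      (by simp)
  have hε0 := tendsto_spacing hN
  set A : ℕ → ℝ → ℝ := fun n t => ∫ x, interp (N n) (stateAt τ U t n) x *
    ((ψ (x, t + τ n) - ψ (x, t)) / τ n) ∂unitVol with hA
  set B : ℕ → ℝ → ℝ := fun n t => ∫ x, stepFn (N n) (fluxDiff (N n) (stateAt τ U t n)) x *
    ψ (x, t) ∂unitVol with hB
  have hAB : ∀ᶠ n in atTop, ∫ t in Ioi 0, A n t = - ∫ t in Ioi 0, B n t := by
    filter_upwards [hτ.eventually (gt_mem_nhds hδ)] with n hn
    exact (hU n).integral_eq (hN2 n) (hτpos n) (hC n) hψ.continuous hc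
      fun p hp => hn.trans (hm' p hp).2.2.1
  have hquot_cont : ∀ n, Continuous fun p : ℝ × ℝ => (ψ (p.1, p.2 + τ n) - ψ p) / τ n := fun n =>
    ((hψ.continuous.comp (by fun_prop)).sub hψ.continuous).div_const _
  have hquot_le : ∀ n x t, |(ψ (x, t + τ n) - ψ (x, t)) / τ n| ≤ K₁ := by
    intro n x t
    rw [abs_div, abs_of_pos (hτpos n), div_le_iff₀ (hτpos n)]
    refine (hK₁ _ _).trans_eq ?_
    rw [Prod.dist_eq, dist_self, Real.dist_eq, add_sub_cancel_left, abs_of_pos (hτpos n),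
      max_eq_right (hτpos n).le]
  have hbound : ∀ c : ℝ, Integrable ((Iio T).indicator fun _ => c)
      (volume.restrict (Ioi (0 : ℝ))) := fun c => by
    rw [integrable_indicator_iff measurableSet_Iio]
    refine integrableOn_const ?_
    rw [Measure.restrict_apply measurableSet_Iio, inter_comm, Ioi_inter_Iio]
    simp
  -- The maximum principle and the Lipschitz bound on `ψ` dominate the slices by `C * K₁`, and they
  -- vanish for `t ≥ T`.
  have hAlim : Tendsto (fun n => ∫ t in Ioi 0, A n t) atTop
      (𝓝 (∫ t in Ioi 0, ∫ x, u x t * deriv (fun s => ψ (x, s)) t ∂unitVol)) := by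
    refine tendsto_integral_filter_of_dominated_convergence
      ((Iio T).indicator fun _ => C * K₁) (Eventually.of_forall fun n => ?_)
      (Eventually.of_forall fun n => ?_) (hbound _) ?_
    · have := stronglyMeasurable_slice_integral (fun k i => nodal (N n) (U n k) i) 0 (τ n)
        (spacing (N n)) (hquot_cont n)
      simp only [sub_zero] at this
      exact this.aestronglyMeasurable
    · filter_upwards with t
      by_cases ht : t ∈ Iio T
      · rw [indicator_of_mem ht]
        refine (norm_integral_le_of_norm_le_const (C := C * K₁)
          (Eventually.of_forall fun x => ?_)).trans (by simp)
        rw [norm_mul]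
        exact mul_le_mul (hC _ _ _) (hquot_le n x t) (norm_nonneg _) hC0
      · rw [indicator_of_notMem ht]
        have hT' : T ≤ t := not_lt.1 ht
        have hz : ∀ x s, T ≤ s → ψ (x, s) = 0 := fun x s hs => by
          by_contra h
          exact absurd (hm' _ h).2.2.2 (not_lt.2 hs)
        simp [hA, hz _ t hT', hz _ (t + τ n) (by linarith [hτpos n])]
    · filter_upwards [ae_restrict_mem measurableSet_Ioi] with t ht
      refine (hlim t (le_of_lt ht)).integral_mul_of_uniform
        (fun n => memLp_interp (hN2 n) _ _) (B := C ^ 2)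
        (Eventually.of_forall fun n => integral_interp_sq_le (hC n _)) (fun n => ?_)
        (memLp_slice hcont_t hcs_t t) (r := fun n => K₂ * τ n) (by simpa using hτ.const_mul K₂)
        (Eventually.of_forall fun n x => ?_)
      · exact MemLp.of_bound ((hquot_cont n).comp (by fun_prop :
          Continuous fun x : ℝ => (x, t))).aestronglyMeasurable K₁
          (Eventually.of_forall fun x => hquot_le n x t)
      · have := abs_sub_sub_mul_deriv_le (hdiff_t x) hK₂0 (hK₂ x) t (τ n)
        have e : (ψ (x, t + τ n) - ψ (x, t)) / τ n - deriv (fun s => ψ (x, s)) t =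
            (ψ (x, t + τ n) - ψ (x, t) - τ n * deriv (fun s => ψ (x, s)) t) / τ n := by
          have := (hτpos n).ne'
          field_simp
        rw [e, abs_div, abs_of_pos (hτpos n), div_le_iff₀ (hτpos n)]
        linarith
  -- Domination comes from moving the difference onto `ψ` and using the `L²` bound `4 * M` of the
  -- fluxes. At a.e. `t` the limit `-2∫ u_x ψ_x` is integrated by parts with `hH1`.
  have hBlim : Tendsto (fun n => ∫ t in Ioi 0, B n t) atTop
      (𝓝 (∫ t in Ioi 0, 2 * ∫ x, uxx x t * ψ (x, t) ∂unitVol)) := by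
    refine tendsto_integral_filter_of_dominated_convergence
      ((Iio T).indicator fun _ => √(4 * M) * √(K₁ ^ 2)) (Eventually.of_forall fun n => ?_)
      ?_ (hbound _) ?_
    · have := stronglyMeasurable_slice_integral (fun k i => fluxDiff (N n) (U n k) i) 0 (τ n)
        (spacing (N n)) hψ.continuous
      simp only [sub_zero] at this
      exact this.aestronglyMeasurable
    · filter_upwards [hε0.eventually (gt_mem_nhds hδ)] with n hn
      filter_upwards with t
      have hε := spacing_pos (hN2 n)
      by_cases ht : t ∈ Iio T
      · rw [indicator_of_mem ht]
        simp only [hB]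
        rw [integral_fluxDiff_mul (hN2 n) _
          ((hslice t).continuous.integrable_of_hasCompactSupport (hslice_c t)) fun x hx =>
            ⟨hn.trans (hm' _ hx).1, by linarith [(hm' _ hx).2.1]⟩]
        have hq : ∀ x, |(ψ (x, t) - ψ (x + spacing (N n), t)) / spacing (N n)| ≤ K₁ := by
          intro x
          rw [abs_div, abs_of_pos hε, div_le_iff₀ hε]
          refine (hK₁ _ _).trans_eq ?_
          rw [Prod.dist_eq, dist_self, Real.dist_eq, sub_add_cancel_left, abs_neg, abs_of_pos hε,
            max_eq_left hε.le]
        have hq2 : MemLp (fun x => (ψ (x, t) - ψ (x + spacing (N n), t)) / spacing (N n)) 2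
            unitVol :=
          memLp_unitVol_of_continuous (((hslice t).continuous.sub ((hslice t).continuous.comp
            (continuous_id.add continuous_const))).div_const _)
            (hasCompactSupport_diffQuot (hslice_c t) _ _)
        refine (abs_integral_mul_le (memLp_stepFn (hN2 n) _ _) hq2).trans ?_
        gcongr
        · exact integral_stepFn_bondFlux_sq_le (hN2 n) (hM n _)
        · calc _ ≤ ∫ _, K₁ ^ 2 ∂unitVol := by
                refine integral_mono hq2.integrable_sq (integrable_const _) fun x => ?_
                exact sq_le_sq' (abs_le.1 (hq x)).1 (abs_le.1 (hq x)).2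
            _ = K₁ ^ 2 := by simp
      · rw [indicator_of_notMem ht]
        have hz : ∀ x, ψ (x, t) = 0 := fun x => by
          by_contra h
          exact ht (hm' _ h).2.2.2
        simp [hB, hz]
    · filter_upwards [ae_restrict_mem measurableSet_Ioi, hH1] with t ht hgood
      have h1 := tendsto_integral_fluxDiff_mul hN2 hN (V := stateAt τ U t) (fun n => hM n _) le_rfl
        (hflux t (le_of_lt ht)) (hslice t) (hslice_c t) (hslice_t t)
      have h2 := hgood.2.2 _ (hslice t) (hslice_c t) (hslice_t t)
      simp only [mul_assoc, integral_const_mul] at h1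
      change ∫ x, ux x t * deriv (fun x => ψ (x, t)) x ∂unitVol =
        - ∫ x, uxx x t * ψ (x, t) ∂unitVol at h2
      rw [h2] at h1
      simp only [mul_neg, neg_neg] at h1
      exact h1
  have hfin := tendsto_nhds_unique (hAlim.congr' hAB) hBlim.neg
  have hsupp_t : ∀ p : ℝ × ℝ, deriv (fun s => ψ (p.1, s)) p.2 ≠ 0 → 0 < p.2 ∧ p.2 < T := by
    intro p hp
    have hp' : p ∈ tsupport ψ := by
      by_contra h
      exact hp (deriv_snd_eq_zero hψ h)
    exact ⟨hδ.trans (hm p hp').2.2.1, (hm p hp').2.2.2⟩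
  have e1 : ∫ p in Ioo (0 : ℝ) 1 ×ˢ Ioi (0 : ℝ), u p.1 p.2 * deriv (fun s => ψ (p.1, s)) p.2 =
      ∫ t in Ioi 0, ∫ x, u x t * deriv (fun s => ψ (x, s)) t ∂unitVol :=
    setIntegral_prod_eq (integrable_mul_test (hu2 T hT0) hcont_t hcs_t hsupp_t)
  have e2 : ∫ p in Ioo (0 : ℝ) 1 ×ˢ Ioi (0 : ℝ), uxx p.1 p.2 * ψ p =
      ∫ t in Ioi 0, ∫ x, uxx x t * ψ (x, t) ∂unitVol :=
    setIntegral_prod_eq (integrable_mul_test (huxx2 T hT0) hψ.continuous hc fun p hp =>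
      ⟨hδ.trans (hm' p hp).2.2.1, (hm' p hp).2.2.2⟩)
  rw [e1, e2, hfin, neg_neg, integral_const_mul]

end PeronaMalik

end

/-! ### Assembly of the theorem. -/

theorem mainTheorem1
    (N : ℕ → ℕ) (hN2 : ∀ n, 2 ≤ N n) (hN : Tendsto N atTop atTop)
    (τ : ℕ → ℝ) (hτpos : ∀ n, 0 < τ n) (hτ : Tendsto τ atTop (𝓝 0))
    (u₀ : (n : ℕ) → Fin (N n + 1) → ℝ)
    (C : ℝ) (hC : ∀ n i, |u₀ n i| ≤ C)
    (M : ℝ) (hM : ∀ n, PeronaMalik.energy (N n) (u₀ n) ≤ M)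
    (U : (n : ℕ) → ℕ → Fin (N n + 1) → ℝ)
    (hU : ∀ n, PeronaMalik.IsDiscreteMovement (N n) (τ n) (u₀ n) (U n))
    (u : ℝ → ℝ → ℝ) (hu : Measurable (Function.uncurry u))
    (hlim : ∀ t : ℝ, 0 ≤ t →
      Tendsto (fun n => eLpNorm (fun x => PeronaMalik.interpST (N n) (τ n) (U n) x t - u x t) 2
        (volume.restrict (Ioo (0 : ℝ) 1))) atTop (𝓝 0)) :
    (∀ uInit : ℝ → ℝ,
      (∀ᵐ x ∂(volume.restrict (Ioo (0 : ℝ) 1)),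
        Tendsto (fun n => PeronaMalik.interp (N n) (u₀ n) x) atTop (𝓝 (uInit x))) →
      ∀ᵐ x ∂(volume.restrict (Ioo (0 : ℝ) 1)), u x 0 = uInit x) ∧
    ∃ ux uxx : ℝ → ℝ → ℝ,
      PeronaMalik.IsL2Local u ∧ PeronaMalik.IsL2Local ux ∧ PeronaMalik.IsL2Local uxx ∧
      (∀ t : ℝ, 0 ≤ t →
        PeronaMalik.IsPiecewiseH1With (fun x => u x t) (fun x => ux x t)) ∧
      PeronaMalik.IsDistribSolution u uxx ∧
      ∀ᵐ t ∂(volume.restrict (Ioi (0 : ℝ))),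
        PeronaMalik.IsH1With (fun x => ux x t) (fun x => uxx x t) ∧
        ContinuousOn (fun x => ux x t) (Icc 0 1) ∧
        ux 0 t = 0 ∧ ux 1 t = 0 ∧
        ∀ x ∈ PeronaMalik.jumpSet (fun y => u y t), ux x t = 0 := by

  have hC' : ∀ n k i, |U n k i| ≤ C := fun n => (hU n).abs_le (hN2 n) (hτpos n) (hC n)
  have hM' : ∀ n k, PeronaMalik.energy (N n) (U n k) ≤ M := fun n =>
    (hU n).energy_le (hN2 n) (hτpos n) (hM n)
  have hum : ∀ t, Measurable fun x => u x t := fun t =>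
    hu.comp (measurable_id.prodMk measurable_const)
  have habs : ∀ t, 0 ≤ t → ∀ᵐ x ∂PeronaMalik.unitVol, |u x t| ≤ C := fun t ht =>
    PeronaMalik.abs_le_of_tendsto_eLpNorm hN2 (V := PeronaMalik.stateAt τ U t)
      (fun n => hC' n _) (hum t).aestronglyMeasurable (hlim t ht)
  have hus : ∀ t, 0 ≤ t → MemLp (fun x => u x t) 2 PeronaMalik.unitVol := fun t ht =>
    MemLp.of_bound (hum t).aestronglyMeasurable C (habs t ht)
  have hweak : ∀ t, 0 ≤ t → PeronaMalik.WeakTendsto PeronaMalik.unitVol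
      (fun n => PeronaMalik.interp (N n) (PeronaMalik.stateAt τ U t n)) atTop
      (fun x => u x t) := fun t ht =>
    PeronaMalik.weakTendsto_of_tendsto_eLpNorm (fun n => PeronaMalik.memLp_interp (hN2 n) _ 2)
      (hus t ht) (hlim t ht)
  have hspec := fun t (ht : 0 ≤ t) => PeronaMalik.limDeriv_spec hN2 hN
    (V := PeronaMalik.stateAt τ U t) (fun n => hM' n _) (fun n => hC' n _) (hus t ht) (hweak t ht)
  have hregular : ∀ t, 0 < t → ∀ R : ℝ, liminf (fun n =>
      ENNReal.ofReal (PeronaMalik.dissipationAt (N n) (τ n) (U n) t)) atTop < ENNReal.ofReal R →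
      _ := fun t ht R hR => PeronaMalik.limDeriv_spec_of_dissipation hN2 hN (R := R)
        (V := PeronaMalik.stateAt τ U t) (fun n => hM' n _) (fun n => hC' n _) (hus t ht.le)
        (hlim t ht.le) (PeronaMalik.frequently_dissipation_le hτpos hτ ht hR)
  have hmeas : Measurable fun t => liminf (fun n =>
      ENNReal.ofReal (PeronaMalik.dissipationAt (N n) (τ n) (U n) t)) atTop :=
    Measurable.liminf fun n => (PeronaMalik.measurable_dissipationAt _ _ _).ennreal_ofReal
  have hfatou := PeronaMalik.lintegral_liminf_dissipation_le hU hN2 hτpos hM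
  have hfin : ∀ᵐ t ∂(volume.restrict (Ioi (0 : ℝ))), liminf (fun n =>
      ENNReal.ofReal (PeronaMalik.dissipationAt (N n) (τ n) (U n) t)) atTop < ⊤ := by
    -- The Fatou estimate is on bounded time intervals, so the half line is exhausted by them.
    have hunion : Ioi (0 : ℝ) = ⋃ k : ℕ, Ioo (0 : ℝ) k := by
      ext t
      simp only [mem_Ioi, mem_iUnion, mem_Ioo]
      exact ⟨fun ht => (exists_nat_gt t).imp fun k hk => ⟨ht, hk⟩, fun ⟨_, h⟩ => h.1⟩
    rw [hunion, ae_restrict_iUnion_iff]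
    exact fun k => ae_lt_top hmeas ((hfatou k).trans_lt ENNReal.ofReal_lt_top).ne
  -- `frequently_dissipation_le` needs a level strictly above the lower limit. For qualitative
  -- conclusions `η = 1` does; for the `L²` bound on `u_xx` all `η > 0` are used.
  have hexists : ∀ {ℓ : ENNReal}, ℓ < ⊤ → ∀ η : ℝ, 0 < η → ℓ < ENNReal.ofReal (ℓ.toReal + η) := by
    intro ℓ hℓ η hη
    rw [ENNReal.lt_ofReal_iff_toReal_lt hℓ.ne]
    linarith
  have hgood : ∀ᵐ t ∂(volume.restrict (Ioi (0 : ℝ))), 0 < t ∧ liminf (fun n =>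
      ENNReal.ofReal (PeronaMalik.dissipationAt (N n) (τ n) (U n) t)) atTop < ⊤ :=
    (ae_restrict_mem measurableSet_Ioi).and hfin
  have hu2 : PeronaMalik.IsL2Local u := fun T _ =>
    PeronaMalik.memLp_prod_of_slices hu (Φ := fun _ => ENNReal.ofReal (C ^ 2)) (by
      filter_upwards [ae_restrict_mem measurableSet_Ioo] with t ht
      refine ⟨hus t ht.1.le, ENNReal.ofReal_le_ofReal ?_⟩
      calc ∫ x, u x t ^ 2 ∂PeronaMalik.unitVol ≤ ∫ _, C ^ 2 ∂PeronaMalik.unitVol := by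
            refine integral_mono_ae (hus t ht.1.le).integrable_sq (integrable_const _) ?_
            filter_upwards [habs t ht.1.le] with x hx
            exact sq_le_sq' (abs_le.1 hx).1 (abs_le.1 hx).2
        _ = C ^ 2 := by simp) (by simp [ENNReal.mul_eq_top])
  have hux2 : PeronaMalik.IsL2Local fun x t =>
      PeronaMalik.limDeriv (PeronaMalik.stateAt τ U t) x := fun T _ =>
    PeronaMalik.memLp_prod_of_slices (PeronaMalik.measurable_limDeriv τ U)
      (Φ := fun _ => ENNReal.ofReal M) (by
      filter_upwards [ae_restrict_mem measurableSet_Ioo] with t ht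
      exact ⟨(hspec t ht.1.le).2.1.2.1, ENNReal.ofReal_le_ofReal (hspec t ht.1.le).1⟩)
      (by simp [ENNReal.mul_eq_top])
  have huxx2 : PeronaMalik.IsL2Local fun x t =>
      PeronaMalik.limDeriv2 (PeronaMalik.stateAt τ U t) x := fun T _ =>
    -- The slice bound is the lower limit of the dissipation itself, integrable in time by `hfatou`;
    -- the spare factor `1/4` is discarded.
    PeronaMalik.memLp_prod_of_slices (PeronaMalik.measurable_limDeriv2 τ U) (by
      filter_upwards [ae_restrict_of_ae_restrict_of_subset Ioo_subset_Ioi_self hgood] with t ht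
      refine ⟨(hregular t ht.1 _ (hexists ht.2 1 one_pos)).1.2.1,
        ENNReal.ofReal_le_of_le_toReal (le_of_forall_pos_le_add fun η hη => ?_)⟩
      have h := (hregular t ht.1 _ (hexists ht.2 η hη)).2.2.2.2.2
      have h0 : 0 ≤ (liminf (fun n => ENNReal.ofReal
        (PeronaMalik.dissipationAt (N n) (τ n) (U n) t)) atTop).toReal := ENNReal.toReal_nonneg
      exact h.trans (by linarith)) ((hfatou T).trans_lt ENNReal.ofReal_lt_top).ne
  refine ⟨fun uInit hInit => ?_, fun x t => PeronaMalik.limDeriv (PeronaMalik.stateAt τ U t) x,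
    fun x t => PeronaMalik.limDeriv2 (PeronaMalik.stateAt τ U t) x, hu2, hux2, huxx2,
    fun t ht => (hspec t ht).2.1, ?_, ?_⟩
  · have hconv : TendstoInMeasure PeronaMalik.unitVol
        (fun n x => PeronaMalik.interpST (N n) (τ n) (U n) x 0) atTop (fun x => u x 0) :=
      tendstoInMeasure_of_tendsto_eLpNorm two_ne_zero
        (fun n => (PeronaMalik.memLp_interp (hN2 n) _ 2).1) (hum 0).aestronglyMeasurable
        (hlim 0 le_rfl)
    obtain ⟨ns, hns, hae⟩ := hconv.exists_seq_tendsto_ae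
    filter_upwards [hae, hInit] with x hx hx2
    refine tendsto_nhds_unique hx ((hx2.comp hns.tendsto_atTop).congr fun k => ?_)
    simp only [Function.comp_apply, PeronaMalik.interpST, zero_div, Nat.floor_zero]
    rw [(hU (ns k)).1]
  · refine PeronaMalik.isDistribSolution_of_limit hN2 hN hτpos hτ hU hC' hM' hu2 huxx2 hweak
      (fun t ht => (hspec t ht).2.2) ?_
    filter_upwards [hgood] with t ht
    exact (hregular t ht.1 _ (hexists ht.2 1 one_pos)).1
  · filter_upwards [hgood] with t ht
    obtain ⟨h1, h2, h3, h4, h5, -⟩ := hregular t ht.1 _ (hexists ht.2 1 one_pos)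
    exact ⟨h1, h2, h3, h4, h5⟩
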